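/- A \emph{prop} is a strict symmetric monoidal category whose objects are the natural numbers, with monoidal product on objects given by addition; $\mathbf{PROP}$ is the category of props and identity-on-objects strict symmetric monoidal functors. Write $[n]=\{0,\dots,n-1\}$. Let $\mathsf F$ be the prop whose arrows $n\to m$ are the functions $[n]\to[m]$, with monoidal product given by disjoint union, and let $\mathsf{Surj},\mathsf{Inj}\subseteq\mathsf F$ be the sub-props of surjections and of injections; $(\mathsf{Surj},\mathsf{Inj})$ is a factorisation system on $\mathsf F$, and $\mathsf{Inj}$ is closed under monoidal product and stable under pushout. Let $\mathsf{Inj}^{op}$ be the opposite prop and $\mathsf{Inj}+\mathsf{Inj}^{op}$ the coproduct in $\mathbf{PROP}$. Consider the following props, with monoidal product and symmetries induced by those of $\mathsf F$. (a) $\mathsf{Cospan}(\mathsf F)$: arrows $n\to m$ are isomorphism classes of cospans $n\xrightarrow{f}k\xleftarrow{g}m$ in $\mathsf F$, composed by pushout. (b) $\mathsf{Span}(\mathsf{Inj})$: arrows $n\to m$ are isomorphism classes of spans $n\xleftarrow{f}k\xrightarrow{g}m$ in $\mathsf{Inj}$, composed by pullback. (c) $\mathsf{Corel}(\mathsf F)$: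 the quotient of $\mathsf{Cospan}(\mathsf F)$ by the equivalence relation generated by identifying $n\xrightarrow{f}k\xleftarrow{g}m$ with $n\xrightarrow{hf}k'\xleftarrow{hg}m$ for every injection $h:k\to k'$. Let $\Gamma:\mathsf{Cospan}(\mathsf F)\to\mathsf{Corel}(\mathsf F)$ be the quotient morphism. (d) $\mathsf{ER}$: arrows $n\to m$ are the equivalence relations on $[n]\uplus[m]$. The composite of $e_1:n\to z$ and $e_2:z\to m$ is the restriction to $[n]\uplus[m]$ of the equivalence relation on $[n]\uplus[z]\uplus[m]$ generated by $e_1$ and $e_2$. The monoidal product is the disjoint union of equivalence relations. The identity on $n$ relates each element of the left copy of $[n]$ to the same element of the right copy (and to nothing else but itself), and the symmetry $n+m\to m+n$ is given in the same way by the block transposition. Then: 1. There is an isomorphism of props $\varphi:\mathsf{Corel}(\mathsf F)\cong\mathsf{ER}$ that sends the corelation represented by $n\xrightarrow{f}k\xleftarrow{g}m$ to the kernel of the copairing $[f,g]:[n]\uplus[m]\to[k]$. 2. There is a morphism of props $\Pi:\mathsf{Span}(\mathsf{Inj})\to\mathsf{Corel}(\mathsf F)$ that sends a span $n\xleftarrow{f}k\xrightarrow{g}m$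 of injections to the corelation represented by the cospan $n\to p\leftarrow m$ that is a pushout of the span in $\mathsf F$. 3. The square $$\begin{array}{ccc}\mathsf{Inj}+\mathsf{Inj}^{op}&\longrightarrow&\mathsf{Span}(\mathsf{Inj})\\ \downarrow&&\downarrow{\scriptstyle\varphi\circ\Pi}\\ \mathsf{Cospan}(\mathsf F)&\xrightarrow{\ \varphi\circ\Gamma\ }&\mathsf{ER}\end{array}$$ is a pushout in $\mathbf{PROP}$. Here $\mathsf{Inj}+\mathsf{Inj}^{op}\to\mathsf{Cospan}(\mathsf F)$ is the copairing of $f\mapsto(\xrightarrow{f}\xleftarrow{id})$ and $g\mapsto(\xrightarrow{id}\xleftarrow{g})$, and $\mathsf{Inj}+\mathsf{Inj}^{op}\to\mathsf{Span}(\mathsf{Inj})$ is the copairing of $f\mapsto(\xleftarrow{id}\xrightarrow{f})$ and $g\mapsto(\xleftarrow{g}\xrightarrow{id})$. The universal property holds with respect to all props, whatever the universe in which their hom-sets live. -/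

import Mathlib

open CategoryTheory CategoryTheory.Limits

universe u v w

/-! Props: strict symmetric monoidal categories with objects the natural numbers. -/

/-- The operations of a prop. Composition is written in diagrammatic order. -/
structure PROPData where
  Hom : ℕ → ℕ → Type u
  id : ∀ n, Hom n n
  comp : ∀ {n m k}, Hom n m → Hom m k → Hom n k
  tensor : ∀ {a b c d}, Hom a b → Hom c d → Hom (a + c) (b + d)
  symm : ∀ a b, Hom (a + b) (b + a)

/-- Transport of an arrow along equalities of its source and target. -/
def PROPData.cast (D : PROPData.{u}) {a a' b b' : ℕ} (h : a = a') (h' : b = b') (f : D.Hom a b) :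
    D.Hom a' b' := h ▸ h' ▸ f

theorem PROPData.map_cast {D : PROPData.{u}} {D' : PROPData.{v}}
    (K : ∀ {n m : ℕ}, D.Hom n m → D'.Hom n m) {a a' b b' : ℕ} (h : a = a') (h' : b = b')
    (f : D.Hom a b) : D'.cast h h' (K f) = K (D.cast h h' f) := by
  subst h h'; rfl

/-- A prop: a strict symmetric monoidal category whose objects are the natural numbers, with
`n ⊗ m = n + m`. Strictness of the tensor on arrows is expressed by transport along the equalities
`a + b + c = a + (b + c)` and `0 + a = a`. -/
structure PROP extends PROPData.{u} where
  id_comp : ∀ {n m} (f : Hom n m), comp (id n) f = f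
  comp_id : ∀ {n m} (f : Hom n m), comp f (id m) = f
  assoc : ∀ {n m k l} (f : Hom n m) (g : Hom m k) (h : Hom k l),
    comp (comp f g) h = comp f (comp g h)
  tensor_id : ∀ a b, tensor (id a) (id b) = id (a + b)
  tensor_comp : ∀ {a b c a' b' c'} (f : Hom a b) (g : Hom b c) (f' : Hom a' b') (g' : Hom b' c'),
    tensor (comp f g) (comp f' g') = comp (tensor f f') (tensor g g')
  tensor_assoc : ∀ {a b c a' b' c'} (f : Hom a a') (g : Hom b b') (h : Hom c c'),
    toPROPData.cast (Nat.add_assoc a b c) (Nat.add_assoc a' b' c') (tensor (tensor f g) h) =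
      tensor f (tensor g h)
  unit_tensor : ∀ {a b} (f : Hom a b),
    toPROPData.cast (Nat.zero_add a) (Nat.zero_add b) (tensor (id 0) f) = f
  tensor_unit : ∀ {a b} (f : Hom a b),
    toPROPData.cast (Nat.add_zero a) (Nat.add_zero b) (tensor f (id 0)) = f
  symm_natural : ∀ {a b c d} (f : Hom a b) (g : Hom c d),
    comp (tensor f g) (symm b d) = comp (symm a c) (tensor g f)
  symm_symm : ∀ a b, comp (symm a b) (symm b a) = id (a + b)
  hexagon : ∀ a b c,
    toPROPData.cast (Nat.add_assoc a b c).symm (Nat.add_assoc b c a) (symm a (b + c)) =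
      comp (toPROPData.cast rfl (Nat.add_assoc b a c) (tensor (symm a b) (id c)))
        (tensor (id b) (symm a c))

namespace PROP

/-- A morphism of props: an identity-on-objects strict symmetric monoidal functor. -/
@[ext]
structure Mor (P : PROP.{u}) (Q : PROP.{v}) where
  map : ∀ {n m : ℕ}, P.Hom n m → Q.Hom n m
  map_id : ∀ n, map (P.id n) = Q.id n
  map_comp : ∀ {n m k} (f : P.Hom n m) (g : P.Hom m k),
    map (P.comp f g) = Q.comp (map f) (map g)
  map_tensor : ∀ {a b c d} (f : P.Hom a b) (g : P.Hom c d),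
    map (P.tensor f g) = Q.tensor (map f) (map g)
  map_symm : ∀ a b, map (P.symm a b) = Q.symm a b

/-- The identity morphism of a prop. -/
def Mor.refl (P : PROP.{u}) : Mor P P where
  map f := f
  map_id _ := rfl
  map_comp _ _ := rfl
  map_tensor _ _ := rfl
  map_symm _ _ := rfl

/-- The composite of two morphisms of props. -/
def Mor.trans {P : PROP.{u}} {Q : PROP.{v}} {R : PROP.{w}} (F : Mor P Q) (G : Mor Q R) :
    Mor P R where
  map f := G.map (F.map f)
  map_id n := by rw [F.map_id, G.map_id]
  map_comp f g := by rw [F.map_comp, G.map_comp]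
  map_tensor f g := by rw [F.map_tensor, G.map_tensor]
  map_symm a b := by rw [F.map_symm, G.map_symm]

/-- The category of props. -/
instance : Category PROP.{u} where
  Hom P Q := Mor P Q
  id P := Mor.refl P
  comp F G := Mor.trans F G

@[simp] theorem comp_map {P Q R : PROP.{u}} (F : P ⟶ Q) (G : Q ⟶ R) {n m : ℕ} (f : P.Hom n m) :
    Mor.map (F ≫ G) f = Mor.map G (Mor.map F f) := rfl

/-- The underlying category of a prop. -/
structure Obj (P : PROP.{u}) where
  n : ℕ

instance (P : PROP.{u}) : Category P.Obj where
  Hom X Y := P.Hom X.n Y.n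
  id X := P.id X.n
  comp f g := P.comp f g
  id_comp := P.id_comp
  comp_id := P.comp_id
  assoc := P.assoc

/-- The natural number `n`, as an object of the prop `P`. -/
abbrev ob (P : PROP.{u}) (n : ℕ) : P.Obj := ⟨n⟩

/-- An arrow of the prop `P`, as an arrow of its underlying category. -/
abbrev ar (P : PROP.{u}) {n m : ℕ} (f : P.Hom n m) : P.ob n ⟶ P.ob m := f

theorem ar_comp (P : PROP.{u}) {n m k : ℕ} (f : P.Hom n m) (g : P.Hom m k) :
    P.ar (P.comp f g) = P.ar f ≫ P.ar g := rfl

/-- Laws pass along a surjective map compatible with the operations. -/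
def ofSurjective (P : PROP.{u}) (D : PROPData.{v}) (K : ∀ {n m : ℕ}, P.Hom n m → D.Hom n m)
    (hK : ∀ {n m : ℕ} (g : D.Hom n m), ∃ f : P.Hom n m, K f = g)
    (K_id : ∀ n, K (P.id n) = D.id n)
    (K_comp : ∀ {n m k} (f : P.Hom n m) (g : P.Hom m k), K (P.comp f g) = D.comp (K f) (K g))
    (K_tensor : ∀ {a b c d} (f : P.Hom a b) (g : P.Hom c d),
      K (P.tensor f g) = D.tensor (K f) (K g))
    (K_symm : ∀ a b, K (P.symm a b) = D.symm a b) : PROP.{v} where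
  toPROPData := D
  id_comp f := by
    obtain ⟨f, rfl⟩ := hK f
    rw [← K_id, ← K_comp, P.id_comp]
  comp_id f := by
    obtain ⟨f, rfl⟩ := hK f
    rw [← K_id, ← K_comp, P.comp_id]
  assoc f g h := by
    obtain ⟨f, rfl⟩ := hK f
    obtain ⟨g, rfl⟩ := hK g
    obtain ⟨h, rfl⟩ := hK h
    simp only [← K_comp, P.assoc]
  tensor_id a b := by simp only [← K_id, ← K_tensor, P.tensor_id]
  tensor_comp f g f' g' := by
    obtain ⟨f, rfl⟩ := hK f
    obtain ⟨g, rfl⟩ := hK g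
    obtain ⟨f', rfl⟩ := hK f'
    obtain ⟨g', rfl⟩ := hK g'
    simp only [← K_comp, ← K_tensor, P.tensor_comp]
  tensor_assoc f g h := by
    obtain ⟨f, rfl⟩ := hK f
    obtain ⟨g, rfl⟩ := hK g
    obtain ⟨h, rfl⟩ := hK h
    rw [← K_tensor, ← K_tensor, ← K_tensor, ← K_tensor, PROPData.map_cast K, P.tensor_assoc]
  unit_tensor f := by
    obtain ⟨f, rfl⟩ := hK f
    rw [← K_id, ← K_tensor, PROPData.map_cast K, P.unit_tensor]
  tensor_unit f := by
    obtain ⟨f, rfl⟩ := hK f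
    rw [← K_id, ← K_tensor, PROPData.map_cast K, P.tensor_unit]
  symm_natural f g := by
    obtain ⟨f, rfl⟩ := hK f
    obtain ⟨g, rfl⟩ := hK g
    simp only [← K_comp, ← K_tensor, ← K_symm, P.symm_natural]
  symm_symm a b := by rw [← K_symm, ← K_symm, ← K_comp, P.symm_symm, K_id]
  hexagon a b c := by
    simp only [← K_symm, ← K_id, ← K_tensor]
    rw [PROPData.map_cast K, PROPData.map_cast K, ← K_comp, P.hexagon]

/-! Opposites and quotients. -/

theorem comp_cast (P : PROP.{u}) {a a' b b' c c' : ℕ} (h : a = a') (h' : b = b') (h'' : c = c')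
    (f : P.Hom a b) (g : P.Hom b c) :
    P.comp (P.cast h h' f) (P.cast h' h'' g) = P.cast h h'' (P.comp f g) := by
  subst h h' h''; rfl

theorem cast_id (P : PROP.{u}) {a a' : ℕ} (h : a = a') : P.cast h h (P.id a) = P.id a' := by
  subst h; rfl

theorem cast_cast (P : PROP.{u}) {a a' a'' b b' b'' : ℕ} (h : a = a') (h' : b = b')
    (k : a' = a'') (k' : b' = b'') (f : P.Hom a b) :
    P.cast k k' (P.cast h h' f) = P.cast (h.trans k) (h'.trans k') f := by
  subst h h' k k'; rfl

/-- The opposite of the operations of a prop. -/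
def opData (D : PROPData.{u}) : PROPData.{u} where
  Hom n m := D.Hom m n
  id n := D.id n
  comp f g := D.comp g f
  tensor f g := D.tensor f g
  symm a b := D.symm b a

theorem opData_cast (D : PROPData.{u}) {a a' b b' : ℕ} (h : a = a') (h' : b = b')
    (f : D.Hom b a) : (opData D).cast h h' f = D.cast h' h f := by
  subst h h'; rfl

/-- The opposite prop. -/
def op (P : PROP.{u}) : PROP.{u} where
  toPROPData := opData P.toPROPData
  id_comp f := P.comp_id f
  comp_id f := P.id_comp f
  assoc f g h := (P.assoc h g f).symm
  tensor_id := P.tensor_id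
  tensor_comp f g f' g' := P.tensor_comp g f g' f'
  tensor_assoc f g h := (opData_cast _ _ _ _).trans (P.tensor_assoc f g h)
  unit_tensor f := (opData_cast _ _ _ _).trans (P.unit_tensor f)
  tensor_unit f := (opData_cast _ _ _ _).trans (P.tensor_unit f)
  symm_natural f g := (P.symm_natural g f).symm
  symm_symm a b := P.symm_symm a b
  hexagon a b c := by
    refine (opData_cast P.toPROPData _ _ _).trans (.trans ?_ (congrArg
      (fun t => P.comp (P.tensor (P.id b) (P.symm c a)) t)
      (opData_cast P.toPROPData rfl (Nat.add_assoc b a c)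
        (P.tensor (P.symm b a) (P.id c))).symm))
    have key : ∀ {x y : ℕ} (f : P.Hom x y) (g g' : P.Hom y x), P.comp f g = P.id x →
        P.comp g' f = P.id y → g = g' := by
      intro x y f g g' h h'
      rw [← P.id_comp g, ← h', P.assoc, h, P.comp_id]
    refine key (P.cast (Nat.add_assoc a b c).symm (Nat.add_assoc b c a) (P.symm a (b + c))) _ _
      ?_ ?_
    · refine (P.comp_cast _ _ _ _ _).trans ?_
      exact (congrArg _ (P.symm_symm a (b + c))).trans (P.cast_id _)
    · rw [P.hexagon]
      rw [P.assoc, ← P.assoc (P.cast _ _ _), P.comp_cast (Nat.add_assoc b a c) rfl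
        (Nat.add_assoc b a c), ← P.tensor_comp, P.symm_symm, P.comp_id, P.tensor_id, P.cast_id,
        P.id_comp, ← P.tensor_comp, P.symm_symm, P.comp_id, P.tensor_id]

theorem op_op (P : PROP.{u}) : P.op.op = P := rfl

/-- Laws pass along an injective map compatible with the operations. -/
def ofInjective (P : PROP.{u}) (D : PROPData.{v}) (K : ∀ {n m : ℕ}, D.Hom n m → P.Hom n m)
    (hK : ∀ {n m : ℕ} (f g : D.Hom n m), K f = K g → f = g)
    (K_id : ∀ n, K (D.id n) = P.id n)
    (K_comp : ∀ {n m k} (f : D.Hom n m) (g : D.Hom m k), K (D.comp f g) = P.comp (K f) (K g))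
    (K_tensor : ∀ {a b c d} (f : D.Hom a b) (g : D.Hom c d),
      K (D.tensor f g) = P.tensor (K f) (K g))
    (K_symm : ∀ a b, K (D.symm a b) = P.symm a b) : PROP.{v} where
  toPROPData := D
  id_comp f := hK _ _ <| by rw [K_comp, K_id, P.id_comp]
  comp_id f := hK _ _ <| by rw [K_comp, K_id, P.comp_id]
  assoc f g h := hK _ _ <| by simp only [K_comp, P.assoc]
  tensor_id a b := hK _ _ <| by simp only [K_id, K_tensor, P.tensor_id]
  tensor_comp f g f' g' := hK _ _ <| by simp only [K_comp, K_tensor, P.tensor_comp]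
  tensor_assoc f g h := hK _ _ <| by
    rw [← PROPData.map_cast K]
    simp only [K_tensor, P.tensor_assoc]
  unit_tensor f := hK _ _ <| by rw [← PROPData.map_cast K, K_tensor, K_id, P.unit_tensor]
  tensor_unit f := hK _ _ <| by rw [← PROPData.map_cast K, K_tensor, K_id, P.tensor_unit]
  symm_natural f g := hK _ _ <| by simp only [K_comp, K_tensor, K_symm, P.symm_natural]
  symm_symm a b := hK _ _ <| by simp only [K_comp, K_symm, K_id, P.symm_symm]
  hexagon a b c := hK _ _ <| by
    rw [← PROPData.map_cast K, K_comp, ← PROPData.map_cast K, K_tensor, K_tensor, K_symm, K_symm,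
      K_symm, K_id, K_id, P.hexagon]

/-- The opposite of a morphism of props. -/
def Mor.op {P : PROP.{u}} {Q : PROP.{v}} (F : Mor P Q) : Mor P.op Q.op where
  map f := F.map f
  map_id n := F.map_id n
  map_comp f g := F.map_comp g f
  map_tensor f g := F.map_tensor f g
  map_symm a b := F.map_symm b a

/-- The quotient of `P` by the equivalence relation generated by a relation `r` on arrows, where `r`
is stable under composition and tensor with arbitrary arrows. -/
def quot (P : PROP.{u}) (r : ∀ n m, P.Hom n m → P.Hom n m → Prop)
    (comp_left : ∀ {n m k} (f : P.Hom n m) (g g' : P.Hom m k), r _ _ g g' →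
      r _ _ (P.comp f g) (P.comp f g'))
    (comp_right : ∀ {n m k} (f f' : P.Hom n m) (g : P.Hom m k), r _ _ f f' →
      r _ _ (P.comp f g) (P.comp f' g))
    (tensor_left : ∀ {a b c d} (f : P.Hom a b) (g g' : P.Hom c d), r _ _ g g' →
      r _ _ (P.tensor f g) (P.tensor f g'))
    (tensor_right : ∀ {a b c d} (f f' : P.Hom a b) (g : P.Hom c d), r _ _ f f' →
      r _ _ (P.tensor f g) (P.tensor f' g)) : PROP.{u} :=
  ofSurjective P
    { Hom n m := Quot (r n m)
      id n := Quot.mk _ (P.id n)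
      comp := Quot.map₂ P.comp comp_left comp_right
      tensor := Quot.map₂ P.tensor tensor_left tensor_right
      symm a b := Quot.mk _ (P.symm a b) }
    (fun f => Quot.mk _ f) Quot.exists_rep (fun _ => rfl) (fun _ _ => rfl) (fun _ _ => rfl)
    (fun _ _ => rfl)

/-! Coproducts of props. -/

/-- Formal composites and tensors of arrows of two props. -/
inductive CoprodTerm (P Q : PROP.{u}) : ℕ → ℕ → Type u
  | inl {n m} : P.Hom n m → CoprodTerm P Q n m
  | inr {n m} : Q.Hom n m → CoprodTerm P Q n m
  | comp {n m k} : CoprodTerm P Q n m → CoprodTerm P Q m k → CoprodTerm P Q n k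
  | tensor {a b c d} : CoprodTerm P Q a b → CoprodTerm P Q c d → CoprodTerm P Q (a + c) (b + d)

/-- The operations on formal terms. -/
def coprodTermData (P Q : PROP.{u}) : PROPData.{u} where
  Hom := CoprodTerm P Q
  id n := .inl (P.id n)
  comp := .comp
  tensor := .tensor
  symm a b := .inl (P.symm a b)

/-- The relations that make formal terms into a prop, and both inclusions into morphisms. -/
inductive CoprodRel (P Q : PROP.{u}) : ∀ {n m : ℕ}, CoprodTerm P Q n m → CoprodTerm P Q n m → Prop
  | inl_comp {n m k} (f : P.Hom n m) (g : P.Hom m k) :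
      CoprodRel P Q (.inl (P.comp f g)) (.comp (.inl f) (.inl g))
  | inl_tensor {a b c d} (f : P.Hom a b) (g : P.Hom c d) :
      CoprodRel P Q (.inl (P.tensor f g)) (.tensor (.inl f) (.inl g))
  | inr_id (n) : CoprodRel P Q (.inr (Q.id n)) (.inl (P.id n))
  | inr_comp {n m k} (f : Q.Hom n m) (g : Q.Hom m k) :
      CoprodRel P Q (.inr (Q.comp f g)) (.comp (.inr f) (.inr g))
  | inr_tensor {a b c d} (f : Q.Hom a b) (g : Q.Hom c d) :
      CoprodRel P Q (.inr (Q.tensor f g)) (.tensor (.inr f) (.inr g))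
  | inr_symm (a b) : CoprodRel P Q (.inr (Q.symm a b)) (.inl (P.symm a b))
  | id_comp {n m} (x : CoprodTerm P Q n m) : CoprodRel P Q (.comp (.inl (P.id n)) x) x
  | comp_id {n m} (x : CoprodTerm P Q n m) : CoprodRel P Q (.comp x (.inl (P.id m))) x
  | assoc {n m k l} (x : CoprodTerm P Q n m) (y : CoprodTerm P Q m k) (z : CoprodTerm P Q k l) :
      CoprodRel P Q (.comp (.comp x y) z) (.comp x (.comp y z))
  | tensor_comp {a b c a' b' c'} (x : CoprodTerm P Q a b) (y : CoprodTerm P Q b c)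
      (x' : CoprodTerm P Q a' b') (y' : CoprodTerm P Q b' c') :
      CoprodRel P Q (.tensor (.comp x y) (.comp x' y')) (.comp (.tensor x x') (.tensor y y'))
  | tensor_assoc {a b c a' b' c'} (x : CoprodTerm P Q a a') (y : CoprodTerm P Q b b')
      (z : CoprodTerm P Q c c') :
      CoprodRel P Q ((coprodTermData P Q).cast (Nat.add_assoc a b c) (Nat.add_assoc a' b' c')
        (.tensor (.tensor x y) z)) (.tensor x (.tensor y z))
  | unit_tensor {a b} (x : CoprodTerm P Q a b) :
      CoprodRel P Q ((coprodTermData P Q).cast (Nat.zero_add a) (Nat.zero_add b)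
        (.tensor (.inl (P.id 0)) x)) x
  | tensor_unit {a b} (x : CoprodTerm P Q a b) :
      CoprodRel P Q ((coprodTermData P Q).cast (Nat.add_zero a) (Nat.add_zero b)
        (.tensor x (.inl (P.id 0)))) x
  | symm_natural {a b c d} (x : CoprodTerm P Q a b) (y : CoprodTerm P Q c d) :
      CoprodRel P Q (.comp (.tensor x y) (.inl (P.symm b d))) (.comp (.inl (P.symm a c)) (.tensor y x))
  | comp_left {n m k} (x : CoprodTerm P Q n m) (y y' : CoprodTerm P Q m k) :
      CoprodRel P Q y y' → CoprodRel P Q (.comp x y) (.comp x y')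
  | comp_right {n m k} (x x' : CoprodTerm P Q n m) (y : CoprodTerm P Q m k) :
      CoprodRel P Q x x' → CoprodRel P Q (.comp x y) (.comp x' y)
  | tensor_left {a b c d} (x : CoprodTerm P Q a b) (y y' : CoprodTerm P Q c d) :
      CoprodRel P Q y y' → CoprodRel P Q (.tensor x y) (.tensor x y')
  | tensor_right {a b c d} (x x' : CoprodTerm P Q a b) (y : CoprodTerm P Q c d) :
      CoprodRel P Q x x' → CoprodRel P Q (.tensor x y) (.tensor x' y)

/-- The operations of the coproduct of two props. -/
def coprodData (P Q : PROP.{u}) : PROPData.{u} where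
  Hom n m := Quot (CoprodRel P Q (n := n) (m := m))
  id n := Quot.mk _ (.inl (P.id n))
  comp := Quot.map₂ .comp .comp_left .comp_right
  tensor := Quot.map₂ .tensor .tensor_left .tensor_right
  symm a b := Quot.mk _ (.inl (P.symm a b))

theorem coprodData_cast (P Q : PROP.{u}) {a a' b b' : ℕ} (h : a = a') (h' : b = b')
    (x : CoprodTerm P Q a b) :
    (coprodData P Q).cast h h' (Quot.mk _ x) = Quot.mk _ ((coprodTermData P Q).cast h h' x) := by
  subst h h'; rfl

theorem coprodTermData_cast_inl (P Q : PROP.{u}) {a a' b b' : ℕ} (h : a = a') (h' : b = b')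
    (f : P.Hom a b) :
    (coprodTermData P Q).cast h h' (.inl f) = .inl (P.cast h h' f) := by
  subst h h'; rfl

/-- The coproduct of two props. -/
def sum (P Q : PROP.{u}) : PROP.{u} where
  toPROPData := coprodData P Q
  id_comp := by rintro n m ⟨x⟩; exact Quot.sound (.id_comp x)
  comp_id := by rintro n m ⟨x⟩; exact Quot.sound (.comp_id x)
  assoc := by rintro n m k l ⟨x⟩ ⟨y⟩ ⟨z⟩; exact Quot.sound (.assoc x y z)
  tensor_id a b := by
    refine (Quot.sound (.inl_tensor (P.id a) (P.id b))).symm.trans ?_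
    rw [P.tensor_id]; rfl
  tensor_comp := by
    rintro a b c a' b' c' ⟨x⟩ ⟨y⟩ ⟨x'⟩ ⟨y'⟩
    exact Quot.sound (.tensor_comp x y x' y')
  tensor_assoc := by
    rintro a b c a' b' c' ⟨x⟩ ⟨y⟩ ⟨z⟩
    exact (coprodData_cast P Q _ _ _).trans (Quot.sound (.tensor_assoc x y z))
  unit_tensor := by
    rintro a b ⟨x⟩
    exact (coprodData_cast P Q _ _ _).trans (Quot.sound (.unit_tensor x))
  tensor_unit := by
    rintro a b ⟨x⟩
    exact (coprodData_cast P Q _ _ _).trans (Quot.sound (.tensor_unit x))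
  symm_natural := by
    rintro a b c d ⟨x⟩ ⟨y⟩
    exact Quot.sound (.symm_natural x y)
  symm_symm a b := by
    refine (Quot.sound (.inl_comp (P.symm a b) (P.symm b a))).symm.trans ?_
    rw [P.symm_symm]; rfl
  hexagon a b c := by
    have e : (coprodData P Q).tensor ((coprodData P Q).symm a b) ((coprodData P Q).id c) =
        Quot.mk _ (.inl (P.tensor (P.symm a b) (P.id c))) :=
      (Quot.sound (.inl_tensor _ _)).symm
    have e' : (coprodData P Q).tensor ((coprodData P Q).id b) ((coprodData P Q).symm a c) =
        Quot.mk _ (.inl (P.tensor (P.id b) (P.symm a c))) :=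
      (Quot.sound (.inl_tensor _ _)).symm
    rw [e, e', coprodData_cast, coprodTermData_cast_inl]
    refine (coprodData_cast P Q _ _ _).trans ?_
    rw [coprodTermData_cast_inl, P.hexagon]
    exact Quot.sound (.inl_comp _ _)

/-- The first inclusion into the coproduct. -/
def sumInl (P Q : PROP.{u}) : P ⟶ sum P Q where
  map f := Quot.mk _ (.inl f)
  map_id _ := rfl
  map_comp f g := Quot.sound (.inl_comp f g)
  map_tensor f g := Quot.sound (.inl_tensor f g)
  map_symm _ _ := rfl

/-- The second inclusion into the coproduct. -/
def sumInr (P Q : PROP.{u}) : Q ⟶ sum P Q where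
  map f := Quot.mk _ (.inr f)
  map_id n := Quot.sound (.inr_id n)
  map_comp f g := Quot.sound (.inr_comp f g)
  map_tensor f g := Quot.sound (.inr_tensor f g)
  map_symm a b := Quot.sound (.inr_symm a b)

/-- Evaluation of formal terms in a prop. -/
def CoprodTerm.eval {P Q R : PROP.{u}} (F : Mor P R) (G : Mor Q R) :
    ∀ {n m : ℕ}, CoprodTerm P Q n m → R.Hom n m
  | _, _, .inl f => F.map f
  | _, _, .inr f => G.map f
  | _, _, .comp x y => R.comp (x.eval F G) (y.eval F G)
  | _, _, .tensor x y => R.tensor (x.eval F G) (y.eval F G)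

theorem CoprodTerm.eval_rel {P Q R : PROP.{u}} (F : Mor P R) (G : Mor Q R) {n m : ℕ}
    {x y : CoprodTerm P Q n m} (h : CoprodRel P Q x y) : x.eval F G = y.eval F G := by
  have hc := @PROPData.map_cast (coprodTermData P Q) R.toPROPData
    (fun {n m} (x : CoprodTerm P Q n m) => x.eval F G)
  induction h with
  | inl_comp f g => exact F.map_comp f g
  | inl_tensor f g => exact F.map_tensor f g
  | inr_id n => exact (G.map_id n).trans (F.map_id n).symm
  | inr_comp f g => exact G.map_comp f g
  | inr_tensor f g => exact G.map_tensor f g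
  | inr_symm a b => exact (G.map_symm a b).trans (F.map_symm a b).symm
  | id_comp x => simp only [eval, F.map_id, R.id_comp]
  | comp_id x => simp only [eval, F.map_id, R.comp_id]
  | assoc x y z => simp only [eval, R.assoc]
  | tensor_comp x y x' y' => simp only [eval, R.tensor_comp]
  | tensor_assoc x y z => refine (hc _ _ _).symm.trans ?_; simp only [eval, R.tensor_assoc]
  | unit_tensor x => refine (hc _ _ _).symm.trans ?_; simp only [eval, F.map_id, R.unit_tensor]
  | tensor_unit x => refine (hc _ _ _).symm.trans ?_; simp only [eval, F.map_id, R.tensor_unit]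
  | symm_natural x y => simp only [eval, F.map_symm, R.symm_natural]
  | comp_left x y y' _ ih => simp only [eval, ih]
  | comp_right x x' y _ ih => simp only [eval, ih]
  | tensor_left x y y' _ ih => simp only [eval, ih]
  | tensor_right x x' y _ ih => simp only [eval, ih]

/-- The morphism out of the coproduct given by two morphisms of props. -/
def sumDesc {P Q R : PROP.{u}} (F : P ⟶ R) (G : Q ⟶ R) : sum P Q ⟶ R where
  map := Quot.lift (CoprodTerm.eval F G) (fun _ _ h => CoprodTerm.eval_rel F G h)
  map_id n := Mor.map_id F n
  map_comp := by rintro n m k ⟨x⟩ ⟨y⟩; rfl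
  map_tensor := by rintro a b c d ⟨x⟩ ⟨y⟩; rfl
  map_symm a b := Mor.map_symm F a b

theorem sum_hom_ext {P Q R : PROP.{u}} {F G : sum P Q ⟶ R}
    (hl : sumInl P Q ≫ F = sumInl P Q ≫ G) (hr : sumInr P Q ≫ F = sumInr P Q ≫ G) : F = G := by
  refine Mor.ext ?_
  funext n m x
  induction x using Quot.ind with
  | mk x =>
  induction x with
  | inl f => exact congrArg (fun H : P ⟶ R => Mor.map H f) hl
  | inr f => exact congrArg (fun H : Q ⟶ R => Mor.map H f) hr
  | comp x y ihx ihy =>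
    refine (Mor.map_comp F (Quot.mk _ x) (Quot.mk _ y)).trans (.trans ?_
      (Mor.map_comp G (Quot.mk _ x) (Quot.mk _ y)).symm)
    rw [ihx, ihy]
  | tensor x y ihx ihy =>
    refine (Mor.map_tensor F (Quot.mk _ x) (Quot.mk _ y)).trans (.trans ?_
      (Mor.map_tensor G (Quot.mk _ x) (Quot.mk _ y)).symm)
    rw [ihx, ihy]

/-- The cofan of inclusions is a coproduct in the category of props. -/
def sumIsColimit (P Q : PROP.{u}) : IsColimit (BinaryCofan.mk (sumInl P Q) (sumInr P Q)) :=
  BinaryCofan.isColimitMk (fun s => sumDesc s.inl s.inr) (fun _ => rfl) (fun _ => rfl)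
    (fun _ _ hl hr => sum_hom_ext hl hr)

instance : HasBinaryCoproducts PROP.{u} :=
  have (P Q : PROP.{u}) : HasColimit (pair P Q) := ⟨⟨⟨_, sumIsColimit P Q⟩⟩⟩
  hasBinaryCoproducts_of_hasColimit_pair _

/-! Cospans and spans. -/

/-- The prop `C` has pushouts, and its monoidal product preserves them. -/
class MonoidalPushouts (C : PROP.{u}) : Prop where
  hasPushouts : HasPushouts C.Obj
  isPushout_tensor : ∀ {z x y p z' x' y' p' : ℕ}
    {f : C.Hom z x} {g : C.Hom z y} {h : C.Hom x p} {i : C.Hom y p}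
    {f' : C.Hom z' x'} {g' : C.Hom z' y'} {h' : C.Hom x' p'} {i' : C.Hom y' p'},
    IsPushout (C.ar f) (C.ar g) (C.ar h) (C.ar i) →
    IsPushout (C.ar f') (C.ar g') (C.ar h') (C.ar i') →
    IsPushout (C.ar (C.tensor f f')) (C.ar (C.tensor g g')) (C.ar (C.tensor h h'))
      (C.ar (C.tensor i i'))

attribute [instance] MonoidalPushouts.hasPushouts

/-- A cospan `n → apex ← m` in a prop. -/
structure CospanRep (C : PROP.{u}) (n m : ℕ) where
  apex : ℕ
  left : C.Hom n apex
  right : C.Hom m apex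

/-- Two cospans are isomorphic if there is an isomorphism of apices compatible with the legs. -/
instance cospanSetoid (C : PROP.{u}) (n m : ℕ) : Setoid (CospanRep C n m) where
  r x y := ∃ e : C.ob x.apex ≅ C.ob y.apex,
    C.ar x.left ≫ e.hom = C.ar y.left ∧ C.ar x.right ≫ e.hom = C.ar y.right
  iseqv :=
    { refl := fun x => ⟨Iso.refl _, Category.comp_id _, Category.comp_id _⟩
      symm := by
        rintro x y ⟨e, h, h'⟩
        exact ⟨e.symm, by simp [← h], by simp [← h']⟩
      trans := by
        rintro x y z ⟨e, h, h'⟩ ⟨e', k, k'⟩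
        exact ⟨e ≪≫ e', by simp [← k, ← h], by simp [← k', ← h']⟩ }

/-- Isomorphism classes of cospans `n → · ← m`. -/
def CospanHom (C : PROP.{u}) (n m : ℕ) : Type u := Quotient (cospanSetoid C n m)

/-- The isomorphism class of the cospan `n → k ← m` with legs `f` and `g`. -/
def cospanMk {C : PROP.{u}} {n m k : ℕ} (f : C.Hom n k) (g : C.Hom m k) : CospanHom C n m :=
  Quotient.mk _ ⟨k, f, g⟩

theorem cospanMk_ind {C : PROP.{u}} {n m : ℕ} {p : CospanHom C n m → Prop}
    (h : ∀ (k : ℕ) (f : C.Hom n k) (g : C.Hom m k), p (cospanMk f g)) (x : CospanHom C n m) :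
    p x := Quotient.ind (fun x => h x.apex x.left x.right) x

theorem cospanMk_eq_iff {C : PROP.{u}} {n m k k' : ℕ} {f : C.Hom n k} {g : C.Hom m k}
    {f' : C.Hom n k'} {g' : C.Hom m k'} : cospanMk f g = cospanMk f' g' ↔
      ∃ e : C.ob k ≅ C.ob k', C.ar f ≫ e.hom = C.ar f' ∧ C.ar g ≫ e.hom = C.ar g' :=
  Quotient.eq (r := cospanSetoid C n m)

/-- Composition of cospans by pushout. -/
noncomputable def cospanComp {C : PROP.{u}} [MonoidalPushouts C] {n m k : ℕ}
    (x : CospanRep C n m) (y : CospanRep C m k) : CospanRep C n k where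
  apex := (pushout (C.ar x.right) (C.ar y.left)).n
  left := C.ar x.left ≫ pushout.inl (C.ar x.right) (C.ar y.left)
  right := C.ar y.right ≫ pushout.inr (C.ar x.right) (C.ar y.left)

theorem cospanComp_eq {C : PROP.{u}} [MonoidalPushouts C] {n m k : ℕ}
    (x : CospanRep C n m) (y : CospanRep C m k) {p : ℕ} (i : C.Hom x.apex p) (j : C.Hom y.apex p)
    (h : IsPushout (C.ar x.right) (C.ar y.left) (C.ar i) (C.ar j)) :
    (Quotient.mk _ (cospanComp x y) : CospanHom C n k) =
      cospanMk (C.comp x.left i) (C.comp y.right j) := by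
  refine Quotient.sound ⟨(IsPushout.of_hasPushout (C.ar x.right) (C.ar y.left)).isoIsPushout _ _ h,
    ?_, ?_⟩
  · change (C.ar x.left ≫ pushout.inl (C.ar x.right) (C.ar y.left)) ≫ _ = C.ar x.left ≫ C.ar i
    rw [Category.assoc, IsPushout.inl_isoIsPushout_hom]
  · change (C.ar y.right ≫ pushout.inr (C.ar x.right) (C.ar y.left)) ≫ _ = C.ar y.right ≫ C.ar j
    rw [Category.assoc, IsPushout.inr_isoIsPushout_hom]

/-- The tensor of two isomorphisms. -/
def tensorIso {C : PROP.{u}} {a b c d : ℕ} (e : C.ob a ≅ C.ob b) (e' : C.ob c ≅ C.ob d) :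
    C.ob (a + c) ≅ C.ob (b + d) where
  hom := C.tensor e.hom e'.hom
  inv := C.tensor e.inv e'.inv
  hom_inv_id := by
    refine (C.tensor_comp _ _ _ _).symm.trans ?_
    exact (congrArg₂ C.tensor e.hom_inv_id e'.hom_inv_id).trans (C.tensor_id _ _)
  inv_hom_id := by
    refine (C.tensor_comp _ _ _ _).symm.trans ?_
    exact (congrArg₂ C.tensor e.inv_hom_id e'.inv_hom_id).trans (C.tensor_id _ _)

/-- The symmetry as an isomorphism. -/
def symmIso (C : PROP.{u}) (a b : ℕ) : C.ob (a + b) ≅ C.ob (b + a) where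
  hom := C.symm a b
  inv := C.symm b a
  hom_inv_id := C.symm_symm a b
  inv_hom_id := C.symm_symm b a

/-- The operations on isomorphism classes of cospans: composition by pushout, componentwise
tensor, and the symmetries of `C` as cospans. -/
noncomputable def cospanData (C : PROP.{u}) [MonoidalPushouts C] : PROPData.{u} where
  Hom n m := CospanHom C n m
  id n := cospanMk (C.id n) (C.id n)
  comp := Quotient.map₂ cospanComp <| by
    rintro x x' ⟨e, h, h'⟩ y y' ⟨d, k, k'⟩
    refine Quotient.exact ((cospanComp_eq x y
      (e.hom ≫ pushout.inl (C.ar x'.right) (C.ar y'.left) :)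
      (d.hom ≫ pushout.inr (C.ar x'.right) (C.ar y'.left) :) ?_).trans ?_)
    · exact (IsPushout.of_hasPushout (C.ar x'.right) (C.ar y'.left)).of_iso (Iso.refl _) e.symm
        d.symm (Iso.refl _) (by simp [← h']) (by simp [← k]) (by simp [ar]) (by simp [ar])
    · have hl : C.comp x.left (e.hom ≫ pushout.inl (C.ar x'.right) (C.ar y'.left) :) =
          C.ar x'.left ≫ pushout.inl (C.ar x'.right) (C.ar y'.left) := by
        rw [← h, Category.assoc]; rfl
      have hr : C.comp y.right (d.hom ≫ pushout.inr (C.ar x'.right) (C.ar y'.left) :) =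
          C.ar y'.right ≫ pushout.inr (C.ar x'.right) (C.ar y'.left) := by
        rw [← k', Category.assoc]; rfl
      rw [hl, hr]; rfl
  tensor := Quotient.map₂ (fun x y => ⟨x.apex + y.apex, C.tensor x.left y.left,
      C.tensor x.right y.right⟩) <| by
    rintro x x' ⟨e, h, h'⟩ y y' ⟨d, k, k'⟩
    exact ⟨tensorIso e d,
      (C.tensor_comp _ _ _ _).symm.trans (congrArg₂ C.tensor h k),
      (C.tensor_comp _ _ _ _).symm.trans (congrArg₂ C.tensor h' k')⟩
  symm a b := cospanMk (C.symm a b) (C.id (b + a))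

section

variable {C : PROP.{u}} [MonoidalPushouts C]

theorem cospanData_comp_mk {n m k x y p : ℕ} (f : C.Hom n x) (g : C.Hom m x) (h : C.Hom m y)
    (l : C.Hom k y) (i : C.Hom x p) (j : C.Hom y p)
    (hp : IsPushout (C.ar g) (C.ar h) (C.ar i) (C.ar j)) :
    (cospanData C).comp (cospanMk f g) (cospanMk h l) = cospanMk (C.comp f i) (C.comp l j) :=
  cospanComp_eq ⟨x, f, g⟩ ⟨y, h, l⟩ i j hp

theorem exists_isPushout {n x y : ℕ} (f : C.Hom n x) (g : C.Hom n y) :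
    ∃ (p : ℕ) (i : C.Hom x p) (j : C.Hom y p),
      IsPushout (C.ar f) (C.ar g) (C.ar i) (C.ar j) :=
  ⟨_, _, _, IsPushout.of_hasPushout (C.ar f) (C.ar g)⟩

theorem cospanData_tensor_mk {a b c d x y : ℕ} (f : C.Hom a x) (g : C.Hom b x) (h : C.Hom c y)
    (l : C.Hom d y) : (cospanData C).tensor (cospanMk f g) (cospanMk h l) =
      cospanMk (C.tensor f h) (C.tensor g l) := rfl

theorem cospanData_cast_mk {a a' b b' x x' : ℕ} (h : a = a') (h' : b = b') (h'' : x = x')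
    (f : C.Hom a x) (g : C.Hom b x) : (cospanData C).cast h h' (cospanMk f g) =
      cospanMk (C.cast h h'' f) (C.cast h' h'' g) := by
  subst h h' h''; rfl

theorem cospanData_comp_hom {n m k x : ℕ} (f : C.Hom n m) (g : C.Hom m x) (l : C.Hom k x) :
    (cospanData C).comp (cospanMk f (C.id m)) (cospanMk g l) = cospanMk (C.comp f g) l := by
  refine (cospanData_comp_mk _ _ _ _ g (C.id x) ?_).trans (by rw [C.comp_id])
  exact IsPushout.of_id_fst

theorem cospanData_comp_op {n m k x : ℕ} (f : C.Hom n x) (g : C.Hom m x) (l : C.Hom k m) :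
    (cospanData C).comp (cospanMk f g) (cospanMk (C.id m) l) = cospanMk f (C.comp l g) := by
  refine (cospanData_comp_mk _ _ _ _ (C.id x) g ?_).trans (by rw [C.comp_id])
  exact IsPushout.of_id_snd

end

/-- The prop `Cospan(C)` of isomorphism classes of cospans in `C`. -/
noncomputable def cospan (C : PROP.{u}) [MonoidalPushouts C] : PROP.{u} where
  toPROPData := cospanData C
  id_comp x := by
    induction x using cospanMk_ind with
    | h k f g => exact (cospanData_comp_hom _ _ _).trans (by rw [C.id_comp])
  comp_id x := by
    induction x using cospanMk_ind with
    | h k f g => exact (cospanData_comp_op _ _ _).trans (by rw [C.id_comp])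
  assoc x y z := by
    induction x using cospanMk_ind with | h a f f' =>
    induction y using cospanMk_ind with | h b g g' =>
    induction z using cospanMk_ind with | h c h h' =>
    obtain ⟨p, i, j, P⟩ := exists_isPushout f' g
    obtain ⟨q, k, l, Q⟩ := exists_isPushout g' h
    obtain ⟨r, s, t, R⟩ := exists_isPushout j k
    rw [cospanData_comp_mk _ _ _ _ _ _ P, cospanData_comp_mk _ _ _ _ _ _ Q]
    refine (cospanData_comp_mk _ _ _ _ s (C.comp l t)
      (Q.flip.paste_vert R.flip).flip).trans ?_
    refine Eq.trans ?_ (cospanData_comp_mk _ _ _ _ (C.comp i s) t (P.paste_vert R)).symm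
    exact congrArg₂ cospanMk (C.assoc _ _ _) (C.assoc _ _ _).symm
  tensor_id a b := by
    refine (cospanData_tensor_mk _ _ _ _).trans ?_
    rw [C.tensor_id]; rfl
  tensor_comp x y x' y' := by
    induction x using cospanMk_ind with | h a f f' =>
    induction y using cospanMk_ind with | h b g g' =>
    induction x' using cospanMk_ind with | h c h h' =>
    induction y' using cospanMk_ind with | h d k k' =>
    obtain ⟨p, i, j, P⟩ := exists_isPushout f' g
    obtain ⟨q, i', j', Q⟩ := exists_isPushout h' k
    rw [cospanData_comp_mk _ _ _ _ _ _ P, cospanData_comp_mk _ _ _ _ _ _ Q]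
    refine Eq.trans ?_ (cospanData_comp_mk _ _ _ _ _ _
      (MonoidalPushouts.isPushout_tensor P Q)).symm
    exact congrArg₂ cospanMk (C.tensor_comp _ _ _ _) (C.tensor_comp _ _ _ _)
  tensor_assoc x y z := by
    induction x using cospanMk_ind with | h a f f' =>
    induction y using cospanMk_ind with | h b g g' =>
    induction z using cospanMk_ind with | h c h h' =>
    refine (cospanData_cast_mk _ _ (Nat.add_assoc a b c) _ _).trans ?_
    rw [C.tensor_assoc, C.tensor_assoc]; rfl
  unit_tensor x := by
    induction x using cospanMk_ind with | h a f f' =>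
    refine (cospanData_cast_mk _ _ (Nat.zero_add a) _ _).trans ?_
    rw [C.unit_tensor, C.unit_tensor]
  tensor_unit x := by
    induction x using cospanMk_ind with | h a f f' =>
    refine (cospanData_cast_mk _ _ (Nat.add_zero a) _ _).trans ?_
    rw [C.tensor_unit, C.tensor_unit]
  symm_natural {a b c d} x y := by
    induction x using cospanMk_ind with | h k f f' =>
    induction y using cospanMk_ind with | h l g g' =>
    refine Eq.trans ?_ (cospanData_comp_hom (C.symm a c) (C.tensor g f) (C.tensor g' f')).symm
    refine (cospanData_comp_mk (C.tensor f g) (C.tensor f' g') (C.symm b d) (C.id (d + b))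
      (C.symm k l) (C.tensor g' f') ?_).trans ?_
    · have : IsIso (C.ar (C.symm b d)) := (symmIso C b d).isIso_hom
      have : IsIso (C.ar (C.symm k l)) := (symmIso C k l).isIso_hom
      exact IsPushout.of_vert_isIso ⟨C.symm_natural _ _⟩
    · rw [C.id_comp, C.symm_natural]
  symm_symm a b := by
    refine (cospanData_comp_hom _ _ _).trans ?_
    rw [C.symm_symm]; rfl
  hexagon a b c := by
    have e : (cospanData C).tensor ((cospanData C).symm a b) ((cospanData C).id c) =
        cospanMk (C.tensor (C.symm a b) (C.id c)) (C.id (b + a + c)) :=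
      (cospanData_tensor_mk _ _ _ _).trans (by rw [C.tensor_id])
    have e' : (cospanData C).tensor ((cospanData C).id b) ((cospanData C).symm a c) =
        cospanMk (C.tensor (C.id b) (C.symm a c)) (C.id (b + (c + a))) :=
      (cospanData_tensor_mk _ _ _ _).trans (by rw [C.tensor_id])
    rw [e, e', cospanData_cast_mk _ _ (Nat.add_assoc b a c), C.cast_id, cospanData_comp_hom]
    refine (cospanData_cast_mk _ _ (Nat.add_assoc b c a) _ _).trans ?_
    rw [C.cast_id, C.hexagon]

/-- The morphism `C → Cospan(C)` that maps `f` to the cospan with legs `f` and the identity. -/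
noncomputable def cospanOfHom (C : PROP.{u}) [MonoidalPushouts C] : C ⟶ C.cospan where
  map {_ m} f := cospanMk f (C.id m)
  map_id _ := rfl
  map_comp f g := (cospanData_comp_hom f g _).symm
  map_tensor f g := by
    refine Eq.trans ?_ (cospanData_tensor_mk _ _ _ _).symm
    rw [C.tensor_id]
  map_symm _ _ := rfl

/-- The morphism `Cᵒᵖ → Cospan(C)` that maps `g` to the cospan with legs the identity and `g`. -/
noncomputable def cospanOfOp (C : PROP.{u}) [MonoidalPushouts C] : C.op ⟶ C.cospan where
  map {n _} g := cospanMk (C.id n) g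
  map_id _ := rfl
  map_comp {n m k} f g :=
    (cospanData_comp_op (C := C) (n := n) (m := m) (k := k) (x := n) (C.id n) f g).symm
  map_tensor {a b c d} f g := by
    refine Eq.trans ?_ (cospanData_tensor_mk (C := C) (C.id a) f (C.id c) g).symm
    rw [C.tensor_id]; rfl
  map_symm a b := cospanMk_eq_iff.2 ⟨symmIso C a b, C.id_comp _, C.symm_symm b a⟩

/-- The prop `Span(A)` of isomorphism classes of spans in `A`, for `A` with pullbacks preserved by
the monoidal product. A span in `A` is a cospan in the opposite of `A`, and spans are composed by
pullback in `A`, that is, by pushout in the opposite of `A`. -/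
noncomputable abbrev span (A : PROP.{u}) [MonoidalPushouts A.op] : PROP.{u} := A.op.cospan

/-- The isomorphism class of the span `n ← k → m` with legs `f` and `g`. -/
def spanMk {A : PROP.{u}} [MonoidalPushouts A.op] {n m k : ℕ} (f : A.Hom k n) (g : A.Hom k m) :
    A.span.Hom n m :=
  cospanMk (C := A.op) f g

/-- The morphism `A → Span(A)` that maps `g` to the span with legs the identity and `g`. -/
noncomputable def spanOfHom (A : PROP.{u}) [MonoidalPushouts A.op] : A ⟶ A.span :=
  cospanOfOp A.op

/-- The morphism `Aᵒᵖ → Span(A)` that maps `f` to the span with legs `f` and the identity. -/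
noncomputable def spanOfOp (A : PROP.{u}) [MonoidalPushouts A.op] : A.op ⟶ A.span :=
  cospanOfHom A.op

/-! Corelations. -/

/-- A factorisation system on a category. -/
structure FactorisationSystem (C : Type v) [Category.{u} C] where
  E : MorphismProperty C
  M : MorphismProperty C
  E_mul : E.IsMultiplicative
  M_mul : M.IsMultiplicative
  E_iso : ∀ {X Y : C} (f : X ⟶ Y), IsIso f → E f
  M_iso : ∀ {X Y : C} (f : X ⟶ Y), IsIso f → M f
  exists_fac : ∀ {X Y : C} (f : X ⟶ Y), ∃ (Z : C) (e : X ⟶ Z) (m : Z ⟶ Y), E e ∧ M m ∧ e ≫ m = f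
  existsUnique_diag : ∀ {X Y Z X' Y' Z' : C} (e : X ⟶ Z) (m : Z ⟶ Y) (e' : X' ⟶ Z') (m' : Z' ⟶ Y'),
    E e → M m → E e' → M m' → ∀ (u : X ⟶ X') (v : Y ⟶ Y'), (e ≫ m) ≫ v = u ≫ e' ≫ m' →
      ∃! s : Z ⟶ Z', e ≫ s = u ≫ e' ∧ s ≫ m' = m ≫ v

/-- A factorisation system on a prop that is costable and whose right class is closed under the
monoidal product. -/
structure CostableSystem (C : PROP.{u}) extends FactorisationSystem C.Obj where
  costable : M.IsStableUnderCobaseChange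
  M_tensor : ∀ {a b c d : ℕ} (f : C.Hom a b) (g : C.Hom c d), M (C.ar f) → M (C.ar g) →
    M (C.ar (C.tensor f g))

/-- The basic relation between cospans that generates equality of corelations: there is a map of
cospans from one to the other whose map of apices lies in the right class. -/
def corelRel {C : PROP.{u}} (S : CostableSystem C) (n m : ℕ) (x y : CospanHom C n m) : Prop :=
  ∃ (k l : ℕ) (f : C.Hom n k) (g : C.Hom m k) (i : C.Hom k l), S.M (C.ar i) ∧
    x = cospanMk f g ∧ y = cospanMk (C.comp f i) (C.comp g i)

/-- The prop `Corel(C)` of corelations: cospans modulo the equivalence relation generated by maps of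
cospans in the right class of the factorisation system. -/
noncomputable def corel {C : PROP.{u}} [MonoidalPushouts C] (S : CostableSystem C) : PROP.{u} :=
  C.cospan.quot (corelRel S)
    (by
      rintro n m k x _ _ ⟨a, b, f, g, i, hi, rfl, rfl⟩
      induction x using cospanMk_ind with | h c h h' =>
      obtain ⟨p, j, j', P⟩ := exists_isPushout h' f
      obtain ⟨q, r, s, Q⟩ := exists_isPushout j' i
      refine ⟨_, _, C.comp h j, C.comp g j', r, S.costable.of_isPushout Q hi,
        cospanData_comp_mk _ _ _ _ _ _ P, ?_⟩
      refine (cospanData_comp_mk _ _ _ _ (C.comp j r) s (P.paste_vert Q)).trans ?_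
      rw [C.assoc, C.assoc, C.assoc]
      exact congrArg (fun t => cospanMk _ (C.comp g t)) Q.w.symm)
    (by
      rintro n m k _ _ x ⟨a, b, f, g, i, hi, rfl, rfl⟩
      induction x using cospanMk_ind with | h c h h' =>
      obtain ⟨p, j, j', P⟩ := exists_isPushout g h
      obtain ⟨q, r, s, Q⟩ := exists_isPushout j i
      refine ⟨_, _, C.comp f j, C.comp h' j', r, S.costable.of_isPushout Q hi,
        cospanData_comp_mk _ _ _ _ _ _ P, ?_⟩
      refine (cospanData_comp_mk _ _ _ _ s (C.comp j' r) (P.flip.paste_vert Q).flip).trans ?_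
      rw [C.assoc, C.assoc, C.assoc]
      exact congrArg (fun t => cospanMk (C.comp f t) _) Q.w.symm)
    (by
      rintro n m k l x _ _ ⟨a, b, f, g, i, hi, rfl, rfl⟩
      induction x using cospanMk_ind with | h c h h' =>
      refine ⟨_, _, C.tensor h f, C.tensor h' g, C.tensor (C.id c) i,
        S.M_tensor _ _ (S.M_iso _ (inferInstanceAs (IsIso (𝟙 (C.ob c))))) hi, rfl, ?_⟩
      rw [← C.tensor_comp, ← C.tensor_comp, C.comp_id, C.comp_id]; rfl)
    (by
      rintro n m k l _ _ x ⟨a, b, f, g, i, hi, rfl, rfl⟩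
      induction x using cospanMk_ind with | h c h h' =>
      refine ⟨_, _, C.tensor f h, C.tensor g h', C.tensor i (C.id c),
        S.M_tensor _ _ hi (S.M_iso _ (inferInstanceAs (IsIso (𝟙 (C.ob c))))), rfl, ?_⟩
      rw [← C.tensor_comp, ← C.tensor_comp, C.comp_id, C.comp_id]; rfl)

/-- The corelation represented by the cospan with legs `f` and `g`. -/
noncomputable def corelMk {C : PROP.{u}} [MonoidalPushouts C] (S : CostableSystem C) {n m k : ℕ}
    (f : C.Hom n k) (g : C.Hom m k) : (corel S).Hom n m :=
  Quot.mk _ (cospanMk f g)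

/-- The morphism `Cospan(C) → Corel(C)` that maps a cospan to the corelation it represents. -/
noncomputable def cospanToCorel {C : PROP.{u}} [MonoidalPushouts C] (S : CostableSystem C) :
    C.cospan ⟶ corel S where
  map x := Quot.mk _ x
  map_id _ := rfl
  map_comp _ _ := rfl
  map_tensor _ _ := rfl
  map_symm _ _ := rfl

/-! The prop of functions and its sub-prop of injections. -/

/-- The disjoint union of two functions between finite ordinals. -/
def finTensor {a b c d : ℕ} (f : Fin a → Fin b) (g : Fin c → Fin d) : Fin (a + c) → Fin (b + d) :=
  Fin.addCases (fun i => Fin.castAdd d (f i)) (fun j => Fin.natAdd b (g j))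

/-- The exchange of two blocks. -/
def finSymm (a b : ℕ) : Fin (a + b) → Fin (b + a) :=
  Fin.addCases (fun i => Fin.natAdd b i) (fun j => Fin.castAdd a j)

theorem fin_cases {a b : ℕ} {p : Fin (a + b) → Prop} (hl : ∀ i, p (Fin.castAdd b i))
    (hr : ∀ j, p (Fin.natAdd a j)) (x : Fin (a + b)) : p x := Fin.addCases hl hr x

@[simp] theorem finTensor_left {a b c d : ℕ} (f : Fin a → Fin b) (g : Fin c → Fin d) (i : Fin a) :
    finTensor f g (Fin.castAdd c i) = Fin.castAdd d (f i) := by simp [finTensor]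

@[simp] theorem finTensor_right {a b c d : ℕ} (f : Fin a → Fin b) (g : Fin c → Fin d)
    (i : Fin c) : finTensor f g (Fin.natAdd a i) = Fin.natAdd b (g i) := by simp [finTensor]

@[simp] theorem finSymm_left {a b : ℕ} (i : Fin a) :
    finSymm a b (Fin.castAdd b i) = Fin.natAdd b i := by simp [finSymm]

@[simp] theorem finSymm_right {a b : ℕ} (i : Fin b) :
    finSymm a b (Fin.natAdd a i) = Fin.castAdd a i := by simp [finSymm]

theorem finTensor_comp {a b c a' b' c' : ℕ} (f : Fin a → Fin b) (g : Fin b → Fin c)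
    (f' : Fin a' → Fin b') (g' : Fin b' → Fin c') (x : Fin (a + a')) :
    finTensor (fun i => g (f i)) (fun i => g' (f' i)) x = finTensor g g' (finTensor f f' x) := by
  induction x using fin_cases <;> simp

theorem finTensor_id {a b : ℕ} (x : Fin (a + b)) :
    finTensor (fun i : Fin a => i) (fun i : Fin b => i) x = x := by
  induction x using fin_cases <;> simp

theorem finTensor_assoc {a b c a' b' c' : ℕ} (f : Fin a → Fin a') (g : Fin b → Fin b')
    (h : Fin c → Fin c') (x : Fin (a + (b + c))) :
    Fin.cast (Nat.add_assoc a' b' c') (finTensor (finTensor f g) h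
      (Fin.cast (Nat.add_assoc a b c).symm x)) = finTensor f (finTensor g h) x := by
  induction x using fin_cases with
  | hl i =>
    have : Fin.cast (Nat.add_assoc a b c).symm (Fin.castAdd (b + c) i) =
      Fin.castAdd c (Fin.castAdd b i) := rfl
    simp only [this, finTensor_left]; rfl
  | hr i =>
  induction i using fin_cases with
  | hl i =>
    have : Fin.cast (Nat.add_assoc a b c).symm (Fin.natAdd a (Fin.castAdd c i)) =
      Fin.castAdd c (Fin.natAdd a i) := rfl
    simp only [this, finTensor_left, finTensor_right]; rfl
  | hr i =>
    have : Fin.cast (Nat.add_assoc a b c).symm (Fin.natAdd a (Fin.natAdd b i)) =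
      Fin.natAdd (a + b) i := Fin.ext (by simp [Nat.add_assoc])
    simp only [this, finTensor_right]
    exact Fin.ext (by simp [Nat.add_assoc])

theorem finTensor_zero_left {a b : ℕ} (f : Fin a → Fin b) (x : Fin a) :
    Fin.cast (Nat.zero_add b) (finTensor (fun i : Fin 0 => i) f
      (Fin.cast (Nat.zero_add a).symm x)) = f x := by
  have : Fin.cast (Nat.zero_add a).symm x = Fin.natAdd 0 x := Fin.ext (by simp)
  rw [this, finTensor_right]
  exact Fin.ext (by simp)

theorem finTensor_zero_right {a b : ℕ} (f : Fin a → Fin b) (x : Fin a) :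
    Fin.cast (Nat.add_zero b) (finTensor f (fun i : Fin 0 => i)
      (Fin.cast (Nat.add_zero a).symm x)) = f x := by
  have : Fin.cast (Nat.add_zero a).symm x = Fin.castAdd 0 x := Fin.ext (by simp)
  rw [this, finTensor_left]
  exact Fin.ext (by simp)

theorem finSymm_natural {a b c d : ℕ} (f : Fin a → Fin b) (g : Fin c → Fin d) (x : Fin (a + c)) :
    finSymm b d (finTensor f g x) = finTensor g f (finSymm a c x) := by
  induction x using fin_cases <;> simp

theorem finSymm_symm {a b : ℕ} (x : Fin (a + b)) : finSymm b a (finSymm a b x) = x := by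
  induction x using fin_cases <;> simp

theorem finSymm_hexagon {a b c : ℕ} (x : Fin (a + b + c)) :
    Fin.cast (Nat.add_assoc b c a) (finSymm a (b + c) (Fin.cast (Nat.add_assoc a b c) x)) =
      finTensor (fun i : Fin b => i) (finSymm a c) (Fin.cast (Nat.add_assoc b a c)
        (finTensor (finSymm a b) (fun i : Fin c => i) x)) := by
  induction x using fin_cases with
  | hr i =>
    have h1 : Fin.cast (Nat.add_assoc a b c) (Fin.natAdd (a + b) i) =
      Fin.natAdd a (Fin.natAdd b i) := Fin.ext (by simp [Nat.add_assoc])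
    have h2 : Fin.cast (Nat.add_assoc b a c) (Fin.natAdd (b + a) i) =
      Fin.natAdd b (Fin.natAdd a i) := Fin.ext (by simp [Nat.add_assoc])
    simp only [h1, h2, finTensor_right, finSymm_right]
    rfl
  | hl i =>
  induction i using fin_cases with
  | hl i =>
    have h1 : Fin.cast (Nat.add_assoc a b c) (Fin.castAdd c (Fin.castAdd b i)) =
      Fin.castAdd (b + c) i := rfl
    have h2 : Fin.cast (Nat.add_assoc b a c) (Fin.castAdd c (Fin.natAdd b i)) =
      Fin.natAdd b (Fin.castAdd c i) := rfl
    simp only [h1, h2, finTensor_left, finTensor_right, finSymm_left]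
    exact Fin.ext (by simp [Nat.add_assoc])
  | hr i =>
    have h1 : Fin.cast (Nat.add_assoc a b c) (Fin.castAdd c (Fin.natAdd a i)) =
      Fin.natAdd a (Fin.castAdd c i) := rfl
    have h2 : Fin.cast (Nat.add_assoc b a c) (Fin.castAdd c (Fin.castAdd a i)) =
      Fin.castAdd (a + c) i := rfl
    simp only [h1, h2, finTensor_left, finSymm_right]
    rfl

/-- The operations of the prop of functions between finite ordinals. -/
def fData : PROPData.{0} where
  Hom n m := Fin n → Fin m
  id _ := fun i => i
  comp f g := fun i => g (f i)
  tensor f g := finTensor f g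
  symm a b := finSymm a b

theorem fData_cast {a a' b b' : ℕ} (h : a = a') (h' : b = b') (f : fData.Hom a b) :
    fData.cast h h' f = fun i : Fin a' => Fin.cast h' (f (Fin.cast h.symm i)) := by
  subst h h'; rfl

/-- The prop `F` whose arrows `n → m` are the functions from `Fin n` to `Fin m`. -/
def F : PROP.{0} where
  toPROPData := fData
  id_comp _ := rfl
  comp_id _ := rfl
  assoc _ _ _ := rfl
  tensor_id a b := funext finTensor_id
  tensor_comp f g f' g' := funext (finTensor_comp f g f' g')
  tensor_assoc f g h := (fData_cast _ _ _).trans (funext (finTensor_assoc f g h))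
  unit_tensor f := (fData_cast _ _ _).trans (funext (finTensor_zero_left f))
  tensor_unit f := (fData_cast _ _ _).trans (funext (finTensor_zero_right f))
  symm_natural f g := funext (finSymm_natural f g)
  symm_symm a b := funext finSymm_symm
  hexagon a b c := by
    have e := fData_cast rfl (Nat.add_assoc b a c) (fData.tensor (fData.symm a b) (fData.id c))
    exact (fData_cast _ _ _).trans (.trans (funext finSymm_hexagon) (congrArg (fun t =>
      fData.comp t (fData.tensor (fData.id b) (fData.symm a c))) e.symm))

theorem f_isPushout_mk {z x y p : ℕ} {f : Fin z → Fin x} {g : Fin z → Fin y} {h : Fin x → Fin p}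
    {i : Fin y → Fin p} (w : ∀ t, h (f t) = i (g t))
    (hd : ∀ (k : ℕ) (a : Fin x → Fin k) (b : Fin y → Fin k), (∀ t, a (f t) = b (g t)) →
      ∃ d : Fin p → Fin k, (∀ t, d (h t) = a t) ∧ ∀ t, d (i t) = b t)
    (hs : ∀ s, (∃ t, h t = s) ∨ ∃ t, i t = s) :
    IsPushout (F.ar f) (F.ar g) (F.ar h) (F.ar i) := by
  refine ⟨⟨funext w⟩, ⟨?_⟩⟩
  have key (s : PushoutCocone (F.ar f) (F.ar g)) := hd s.pt.n s.inl s.inr (congrFun s.condition)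
  choose d hl hr using key
  refine PushoutCocone.IsColimit.mk _ d (fun s => funext (hl s)) (fun s => funext (hr s)) ?_
  intro s m hm hm'
  funext q
  obtain ⟨t, rfl⟩ | ⟨t, rfl⟩ := hs q
  · exact (congrFun hm t).trans (hl s t).symm
  · exact (congrFun hm' t).trans (hr s t).symm

/-- The universal property of pushouts in `F`, with values in an arbitrary finite type. -/
theorem f_isPushout_desc {z x y p : ℕ} {f : Fin z → Fin x} {g : Fin z → Fin y} {h : Fin x → Fin p}
    {i : Fin y → Fin p} (sq : IsPushout (F.ar f) (F.ar g) (F.ar h) (F.ar i))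
    {T : Type} [Finite T] (a : Fin x → T) (b : Fin y → T) (hab : ∀ t, a (f t) = b (g t)) :
    ∃ d : Fin p → T, (∀ t, d (h t) = a t) ∧ ∀ t, d (i t) = b t := by
  let e := Finite.equivFin T
  have w : F.ar f ≫ F.ar (fun t => e (a t)) = F.ar g ≫ F.ar (fun t => e (b t)) :=
    funext fun t => congrArg e (hab t)
  refine ⟨fun s => e.symm ((sq.desc _ _ w : Fin p → Fin _) s), fun t => ?_, fun t => ?_⟩
  · exact e.symm_apply_eq.2 (congrFun (sq.inl_desc _ _ w) t)
  · exact e.symm_apply_eq.2 (congrFun (sq.inr_desc _ _ w) t)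

theorem f_isPushout_surj {z x y p : ℕ} {f : Fin z → Fin x} {g : Fin z → Fin y} {h : Fin x → Fin p}
    {i : Fin y → Fin p} (sq : IsPushout (F.ar f) (F.ar g) (F.ar h) (F.ar i)) (s : Fin p) :
    (∃ t, h t = s) ∨ ∃ t, i t = s := by
  classical
  by_contra hs
  push Not at hs
  have : F.ar (fun _ : Fin p => (0 : Fin 2)) = F.ar (fun q : Fin p => if q = s then 1 else 0) := by
    refine sq.hom_ext (funext fun t => ?_) (funext fun t => ?_)
    · exact (if_neg (hs.1 t)).symm
    · exact (if_neg (hs.2 t)).symm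
  have := congrFun this s
  simp at this

theorem f_exists_isPushout {z x y : ℕ} (f : Fin z → Fin x) (g : Fin z → Fin y) :
    ∃ (p : ℕ) (h : Fin x → Fin p) (i : Fin y → Fin p),
      IsPushout (F.ar f) (F.ar g) (F.ar h) (F.ar i) := by
  let r : Fin x ⊕ Fin y → Fin x ⊕ Fin y → Prop :=
    fun a b => ∃ t, a = Sum.inl (f t) ∧ b = Sum.inr (g t)
  let e := Finite.equivFin (Quot r)
  refine ⟨_, fun t => e (Quot.mk r (Sum.inl t)), fun t => e (Quot.mk r (Sum.inr t)),
    f_isPushout_mk (fun t => congrArg e (Quot.sound ⟨t, rfl, rfl⟩)) ?_ ?_⟩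
  · intro k a b hab
    refine ⟨fun s => Quot.lift (Sum.elim a b) ?_ (e.symm s), fun t => ?_, fun t => ?_⟩
    · rintro _ _ ⟨t, rfl, rfl⟩; exact hab t
    · simp
    · simp
  · intro s
    obtain ⟨s, rfl⟩ := e.surjective s
    obtain ⟨s | s⟩ := s
    · exact .inl ⟨s, rfl⟩
    · exact .inr ⟨s, rfl⟩

theorem f_isPushout_tensor {z x y p z' x' y' p' : ℕ} {f : Fin z → Fin x} {g : Fin z → Fin y}
    {h : Fin x → Fin p} {i : Fin y → Fin p} {f' : Fin z' → Fin x'} {g' : Fin z' → Fin y'}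
    {h' : Fin x' → Fin p'} {i' : Fin y' → Fin p'}
    (P : IsPushout (F.ar f) (F.ar g) (F.ar h) (F.ar i))
    (P' : IsPushout (F.ar f') (F.ar g') (F.ar h') (F.ar i')) :
    IsPushout (F.ar (finTensor f f')) (F.ar (finTensor g g')) (F.ar (finTensor h h'))
      (F.ar (finTensor i i')) := by
  refine f_isPushout_mk (fun t => ?_) ?_ ?_
  · have w : ∀ t, h (f t) = i (g t) := congrFun P.w
    have w' : ∀ t, h' (f' t) = i' (g' t) := congrFun P'.w
    induction t using fin_cases <;> simp [w, w']
  · intro k a b hab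
    obtain ⟨d, h1, h2⟩ := f_isPushout_desc P (fun t => a (Fin.castAdd _ t))
      (fun t => b (Fin.castAdd _ t)) (fun t => by simpa using hab (Fin.castAdd _ t))
    obtain ⟨d', h1', h2'⟩ := f_isPushout_desc P' (fun t => a (Fin.natAdd _ t))
      (fun t => b (Fin.natAdd _ t)) (fun t => by simpa using hab (Fin.natAdd _ t))
    refine ⟨Fin.addCases d d', fun t => ?_, fun t => ?_⟩
    · induction t using fin_cases <;> simp [h1, h1']
    · induction t using fin_cases <;> simp [h2, h2']
  · intro s
    induction s using fin_cases with
    | hl s =>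
      obtain ⟨t, ht⟩ | ⟨t, ht⟩ := f_isPushout_surj P s
      · exact .inl ⟨Fin.castAdd _ t, by simp [ht]⟩
      · exact .inr ⟨Fin.castAdd _ t, by simp [ht]⟩
    | hr s =>
      obtain ⟨t, ht⟩ | ⟨t, ht⟩ := f_isPushout_surj P' s
      · exact .inl ⟨Fin.natAdd _ t, by simp [ht]⟩
      · exact .inr ⟨Fin.natAdd _ t, by simp [ht]⟩

instance : MonoidalPushouts F where
  hasPushouts := by
    have (X Y Z : F.Obj) (f : X ⟶ Y) (g : X ⟶ Z) : HasColimit (Limits.span f g) := by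
      obtain ⟨p, h, i, sq⟩ := f_exists_isPushout f g
      exact sq.hasPushout
    exact hasPushouts_of_hasColimit_span _
  isPushout_tensor P P' := f_isPushout_tensor P P'

/-- The class of surjective functions. -/
def surj : MorphismProperty F.Obj := fun X Y f => Function.Surjective (f : Fin X.n → Fin Y.n)

/-- The class of injective functions. -/
def inj : MorphismProperty F.Obj := fun X Y f => Function.Injective (f : Fin X.n → Fin Y.n)

theorem finTensor_injective {a b c d : ℕ} {f : Fin a → Fin b} {g : Fin c → Fin d}
    (hf : Function.Injective f) (hg : Function.Injective g) :
    Function.Injective (finTensor f g) := by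
  intro x y h
  induction x using fin_cases with
  | hl x =>
    induction y using fin_cases with
    | hl y => simp at h; rw [hf h]
    | hr y => have := congrArg Fin.val h; simp at this; omega
  | hr x =>
    induction y using fin_cases with
    | hl y => have := congrArg Fin.val h; simp at this; omega
    | hr y => simp at h; rw [hg h]

theorem surj_comp {a b c : ℕ} {f : Fin a → Fin b} {g : Fin b → Fin c}
    (hf : Function.Surjective f) (hg : Function.Surjective g) :
    Function.Surjective fun i => g (f i) := hg.comp hf

theorem inj_comp {a b c : ℕ} {f : Fin a → Fin b} {g : Fin b → Fin c}
    (hf : Function.Injective f) (hg : Function.Injective g) :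
    Function.Injective fun i => g (f i) := hg.comp hf

theorem exists_surj_inj {a b : ℕ} (f : Fin a → Fin b) :
    ∃ (c : ℕ) (e : Fin a → Fin c) (m : Fin c → Fin b), Function.Surjective e ∧
      Function.Injective m ∧ ∀ t, m (e t) = f t := by
  let d := Finite.equivFin (Set.range f)
  exact ⟨_, fun t => d ⟨f t, t, rfl⟩, fun s => (d.symm s).1,
    d.surjective.comp (fun ⟨_, t, h⟩ => ⟨t, Subtype.ext h⟩),
    Subtype.val_injective.comp d.symm.injective, fun _ =>
      congrArg Subtype.val (d.symm_apply_apply _)⟩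

theorem existsUnique_surj_inj_diag {x y z x' y' z' : ℕ} (e : Fin x → Fin z) (m : Fin z → Fin y)
    (e' : Fin x' → Fin z') (m' : Fin z' → Fin y') (he : Function.Surjective e)
    (hm' : Function.Injective m') (u : Fin x → Fin x') (v : Fin y → Fin y')
    (w : ∀ t, v (m (e t)) = m' (e' (u t))) :
    ∃! s : Fin z → Fin z', (fun t => s (e t)) = (fun t => e' (u t)) ∧
      (fun t => m' (s t)) = fun t => v (m t) := by
  choose k hk using he
  have h1 : ∀ t, e' (u (k (e t))) = e' (u t) := fun t => hm' (by rw [← w, ← w, hk])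
  refine ⟨fun s => e' (u (k s)), ⟨funext h1, funext fun s => ?_⟩, ?_⟩
  · change m' (e' (u (k s))) = v (m s)
    rw [← w, hk]
  · rintro s ⟨hs, -⟩
    funext t
    rw [← hk t]
    exact (congrFun hs (k t)).trans (h1 _).symm

/-- The (surjection, injection) factorisation system on `F`. -/
def surjInj : CostableSystem F where
  E := surj
  M := inj
  E_mul :=
    { id_mem := fun _ => Function.surjective_id
      comp_mem := fun f g (hf : Function.Surjective f) (hg : Function.Surjective g) =>
        surj_comp (f := f) (g := g) hf hg }
  M_mul :=
    { id_mem := fun _ => Function.injective_id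
      comp_mem := fun f g (hf : Function.Injective f) (hg : Function.Injective g) =>
        inj_comp (f := f) (g := g) hf hg }
  E_iso f _ := fun y => ⟨(inv f : _ → Fin _) y, congrFun (IsIso.inv_hom_id f) y⟩
  M_iso f _ := Function.LeftInverse.injective (g := (inv f : _ → Fin _))
    (congrFun (IsIso.hom_inv_id f))
  exists_fac f := by
    obtain ⟨c, e, m, he, hm, h⟩ := exists_surj_inj f
    exact ⟨F.ob c, e, m, he, hm, funext h⟩
  existsUnique_diag e m e' m' he _ _ hm' u v w :=
    existsUnique_surj_inj_diag e m e' m' he hm' u v (congrFun w)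
  costable :=
    { of_isPushout := by
        intro A A' B B' f g f' g' sq hf y y' hy
        classical
        let f₁ : Fin A.n → Fin A'.n := f
        let g₁ : Fin A.n → Fin B.n := g
        have hf : Function.Injective f₁ := hf
        obtain ⟨d, -, hd⟩ := f_isPushout_desc sq.flip (T := Option (Fin B.n))
          (fun a => if h : ∃ t, f₁ t = a then some (g₁ h.choose) else none) some (by
            intro t
            have h : ∃ s, f₁ s = f₁ t := ⟨t, rfl⟩
            change (if h : ∃ s, f₁ s = f₁ t then some (g₁ h.choose) else none) = some (g₁ t)
            rw [dif_pos h, hf h.choose_spec])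
        exact Option.some_injective _ ((hd y).symm.trans ((congrArg d hy).trans (hd y'))) }
  M_tensor f g hf hg := finTensor_injective hf hg

/-- The injective functions from `Fin n` to `Fin m`. -/
abbrev InjFun (n m : ℕ) : Type := {f : Fin n → Fin m // Function.Injective f}

/-- The prop `Inj` of injective functions, a sub-prop of `F`. -/
def Inj : PROP.{0} :=
  ofInjective F
    { Hom n m := InjFun n m
      id _ := ⟨fun i => i, Function.injective_id⟩
      comp f g := ⟨fun i => g.1 (f.1 i), inj_comp f.2 g.2⟩
      tensor f g := ⟨finTensor f.1 g.1, finTensor_injective f.2 g.2⟩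
      symm a b := ⟨finSymm a b, Function.LeftInverse.injective finSymm_symm⟩ }
    Subtype.val (fun _ _ => Subtype.ext) (fun _ => rfl) (fun _ _ => rfl) (fun _ _ => rfl)
    (fun _ _ => rfl)

/-- The inclusion of `Inj` in `F`. -/
def injIncl : Inj ⟶ F where
  map := Subtype.val
  map_id _ := rfl
  map_comp _ _ := rfl
  map_tensor _ _ := rfl
  map_symm _ _ := rfl

theorem inj_isPullback_mk {z x y p : ℕ} {f : InjFun x z} {g : InjFun y z} {h : InjFun p x}
    {i : InjFun p y} (w : ∀ t, f.1 (h.1 t) = g.1 (i.1 t))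
    (hd : ∀ a b, f.1 a = g.1 b → ∃ t, h.1 t = a ∧ i.1 t = b) :
    IsPushout (Inj.op.ar f) (Inj.op.ar g) (Inj.op.ar h) (Inj.op.ar i) := by
  refine ⟨⟨Subtype.ext (p := Function.Injective) (funext w)⟩, ⟨?_⟩⟩
  have key (s : PushoutCocone (Inj.op.ar f) (Inj.op.ar g)) (t : Fin s.pt.n) :
      ∃ q, h.1 q = (s.inl : InjFun s.pt.n x).1 t ∧ i.1 q = (s.inr : InjFun s.pt.n y).1 t :=
    hd _ _ (congrFun (congrArg (Subtype.val (p := Function.Injective)) s.condition) t)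
  choose d hl hr using key
  have hinj (s) : Function.Injective (d s) := fun t t' htt =>
    (s.inl : InjFun s.pt.n x).2 ((hl s t).symm.trans ((congrArg h.1 htt).trans (hl s t')))
  refine PushoutCocone.IsColimit.mk _ (fun s => (⟨d s, hinj s⟩ : InjFun s.pt.n p))
    (fun s => Subtype.ext (p := Function.Injective) (funext (hl s)))
    (fun s => Subtype.ext (p := Function.Injective) (funext (hr s))) ?_
  intro s m hm hm'
  refine Subtype.ext (p := Function.Injective) (funext fun t => h.2 ?_)
  exact (congrFun (congrArg (Subtype.val (p := Function.Injective)) hm) t).trans (hl s t).symm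

theorem inj_isPullback_ex {z x y p : ℕ} {f : InjFun x z} {g : InjFun y z} {h : InjFun p x}
    {i : InjFun p y} (sq : IsPushout (Inj.op.ar f) (Inj.op.ar g) (Inj.op.ar h) (Inj.op.ar i))
    (a : Fin x) (b : Fin y) (hab : f.1 a = g.1 b) : ∃ t, h.1 t = a ∧ i.1 t = b := by
  let a' : InjFun 1 x := ⟨fun _ => a, fun _ _ _ => Subsingleton.elim _ _⟩
  let b' : InjFun 1 y := ⟨fun _ => b, fun _ _ _ => Subsingleton.elim _ _⟩
  have w : Inj.op.ar f ≫ Inj.op.ar (n := x) (m := 1) a' =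
      Inj.op.ar g ≫ Inj.op.ar (n := y) (m := 1) b' :=
    Subtype.ext (p := Function.Injective) (funext fun _ => hab)
  refine ⟨(sq.desc _ _ w : InjFun 1 p).1 0, ?_, ?_⟩
  · exact congrFun (congrArg (Subtype.val (p := Function.Injective)) (sq.inl_desc _ _ w)) 0
  · exact congrFun (congrArg (Subtype.val (p := Function.Injective)) (sq.inr_desc _ _ w)) 0

theorem inj_exists_isPullback {x y z : ℕ} (f : InjFun x z) (g : InjFun y z) :
    ∃ (p : ℕ) (h : InjFun p x) (i : InjFun p y),
      IsPushout (Inj.op.ar f) (Inj.op.ar g) (Inj.op.ar h) (Inj.op.ar i) := by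
  let T := {q : Fin x × Fin y // f.1 q.1 = g.1 q.2}
  let e := Finite.equivFin T
  have h1 : Function.Injective fun t : T => t.1.1 := fun t t' ht =>
    Subtype.ext (Prod.ext ht (g.2 (t.2.symm.trans ((congrArg f.1 ht).trans t'.2))))
  have h2 : Function.Injective fun t : T => t.1.2 := fun t t' ht =>
    Subtype.ext (Prod.ext (f.2 (t.2.trans ((congrArg g.1 ht).trans t'.2.symm))) ht)
  exact ⟨Nat.card T, ⟨fun t => (e.symm t).1.1, h1.comp e.symm.injective⟩,
    ⟨fun t => (e.symm t).1.2, h2.comp e.symm.injective⟩,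
    inj_isPullback_mk (fun t => (e.symm t).2) (fun a b hab => ⟨e ⟨(a, b), hab⟩, by simp, by simp⟩)⟩

theorem inj_isPullback_tensor {z x y p z' x' y' p' : ℕ} {f : InjFun x z} {g : InjFun y z}
    {h : InjFun p x} {i : InjFun p y} {f' : InjFun x' z'} {g' : InjFun y' z'} {h' : InjFun p' x'}
    {i' : InjFun p' y'} (P : IsPushout (Inj.op.ar f) (Inj.op.ar g) (Inj.op.ar h) (Inj.op.ar i))
    (P' : IsPushout (Inj.op.ar f') (Inj.op.ar g') (Inj.op.ar h') (Inj.op.ar i')) :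
    IsPushout (Inj.op.ar (Inj.tensor f f')) (Inj.op.ar (Inj.tensor g g'))
      (Inj.op.ar (Inj.tensor h h')) (Inj.op.ar (Inj.tensor i i')) := by
  refine inj_isPullback_mk (f := Inj.tensor f f') (g := Inj.tensor g g')
    (h := Inj.tensor h h') (i := Inj.tensor i i') ?_ ?_
  · intro t
    change finTensor f.1 f'.1 (finTensor h.1 h'.1 t) = finTensor g.1 g'.1 (finTensor i.1 i'.1 t)
    have w : ∀ t, f.1 (h.1 t) = g.1 (i.1 t) :=
      congrFun (congrArg (Subtype.val (p := Function.Injective)) P.w)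
    have w' : ∀ t, f'.1 (h'.1 t) = g'.1 (i'.1 t) :=
      congrFun (congrArg (Subtype.val (p := Function.Injective)) P'.w)
    induction t using fin_cases <;> simp [w, w']
  · intro a b
    change finTensor f.1 f'.1 a = finTensor g.1 g'.1 b →
      ∃ t, finTensor h.1 h'.1 t = a ∧ finTensor i.1 i'.1 t = b
    intro hab
    induction a using fin_cases with
    | hl a =>
      induction b using fin_cases with
      | hl b =>
        obtain ⟨t, rfl, rfl⟩ := inj_isPullback_ex P a b (by simpa using hab)
        exact ⟨Fin.castAdd _ t, by simp, by simp⟩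
      | hr b => have := congrArg Fin.val hab; simp at this; omega
    | hr a =>
      induction b using fin_cases with
      | hl b => have := congrArg Fin.val hab; simp at this; omega
      | hr b =>
        obtain ⟨t, rfl, rfl⟩ := inj_isPullback_ex P' a b (by simpa using hab)
        exact ⟨Fin.natAdd _ t, by simp, by simp⟩

instance : MonoidalPushouts Inj.op where
  hasPushouts := by
    have (X Y Z : Inj.op.Obj) (f : X ⟶ Y) (g : X ⟶ Z) : HasColimit (Limits.span f g) := by
      obtain ⟨p, h, i, sq⟩ := inj_exists_isPullback f g
      exact sq.hasPushout
    exact hasPushouts_of_hasColimit_span _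
  isPushout_tensor P P' := inj_isPullback_tensor P P'

/-! The prop of equivalence relations. -/

/-- The gluing of two equivalence relations on `α ⊕ β` and `β ⊕ γ`: the equivalence relation on
`α ⊕ β ⊕ γ` generated by both. -/
def glue {α β γ : Type*} (e₁ : Setoid (α ⊕ β)) (e₂ : Setoid (β ⊕ γ)) : Setoid (α ⊕ β ⊕ γ) :=
  Relation.EqvGen.setoid fun x y =>
    (∃ a b, e₁ a b ∧ x = Sum.map id Sum.inl a ∧ y = Sum.map id Sum.inl b) ∨
      ∃ a b, e₂ a b ∧ x = Sum.inr a ∧ y = Sum.inr b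

/-- The disjoint union of two equivalence relations. -/
def sumSetoid {α β : Type*} (e₁ : Setoid α) (e₂ : Setoid β) : Setoid (α ⊕ β) where
  r := Sum.LiftRel e₁ e₂
  iseqv :=
    { refl := by rintro (x | x) <;> simp
      symm := by
        rintro _ _ (h | h)
        · exact .inl (e₁.symm h)
        · exact .inr (e₂.symm h)
      trans := by
        rintro _ _ _ (h | h) (h' | h')
        · exact .inl (e₁.trans h h')
        · exact .inr (e₂.trans h h') }

/-- The bijection that splits `(a + c) ⊎ (b + d)` as `(a ⊎ b) ⊎ (c ⊎ d)`. -/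
def splitSum (a b c d : ℕ) : Fin (a + c) ⊕ Fin (b + d) → (Fin a ⊕ Fin b) ⊕ (Fin c ⊕ Fin d) :=
  Sum.elim (Fin.addCases (fun i => .inl (.inl i)) (fun i => .inr (.inl i)))
    (Fin.addCases (fun i => .inl (.inr i)) (fun i => .inr (.inr i)))

/-- The operations on equivalence relations: an arrow `n → m` is an equivalence relation on
`Fin n ⊕ Fin m`; the composite of two of them is the restriction of their gluing; the tensor is
disjoint union; the identity and the symmetry identify the elements that correspond to each other
under the identity function and under the exchange of blocks. -/
def erData : PROPData.{0} where
  Hom n m := Setoid (Fin n ⊕ Fin m)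
  id _ := Setoid.ker (Sum.elim id id)
  comp e₁ e₂ := (glue e₁ e₂).comap (Sum.map id Sum.inr)
  tensor {a b c d} e₁ e₂ := (sumSetoid e₁ e₂).comap (splitSum a b c d)
  symm a b := Setoid.ker (Sum.elim (finSymm a b) id)

/-- The equivalence relation of a cospan: the kernel of the copairing of its legs. -/
def cospanKer {n m k : ℕ} (f : Fin n → Fin k) (g : Fin m → Fin k) : Setoid (Fin n ⊕ Fin m) :=
  Setoid.ker (Sum.elim f g)

theorem cospanKer_comp {n m k x y p : ℕ} (f : Fin n → Fin x) (g : Fin m → Fin x)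
    (h : Fin m → Fin y) (l : Fin k → Fin y) (i : Fin x → Fin p) (j : Fin y → Fin p)
    (sq : IsPushout (F.ar g) (F.ar h) (F.ar i) (F.ar j)) :
    cospanKer (fun t => i (f t)) (fun t => j (l t)) =
      (glue (cospanKer f g) (cospanKer h l)).comap (Sum.map id Sum.inr) := by
  classical
  have w : ∀ t, i (g t) = j (h t) := congrFun sq.w
  have hker {α β : Type} (u : α → β) (a b : α) : Setoid.ker u a b ↔ u a = u b := Iff.rfl
  let G := glue (cospanKer f g) (cospanKer h l)
  let Q := Quotient G
  have e₁ : ∀ a b, Sum.elim f g a = Sum.elim f g b →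
      (Quotient.mk G (Sum.map id Sum.inl a) : Q) = Quotient.mk G (Sum.map id Sum.inl b) :=
    fun a b hab => Quotient.sound (.rel _ _ (.inl ⟨a, b, hab, rfl, rfl⟩))
  have e₂ : ∀ a b, Sum.elim h l a = Sum.elim h l b →
      (Quotient.mk G (Sum.inr a) : Q) = Quotient.mk G (Sum.inr b) :=
    fun a b hab => Quotient.sound (.rel _ _ (.inr ⟨a, b, hab, rfl, rfl⟩))
  let u : Fin x → Option Q := fun s =>
    if hs : ∃ a, Sum.elim f g a = s then some (Quotient.mk G (Sum.map id Sum.inl hs.choose)) else none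
  let v : Fin y → Option Q := fun s =>
    if hs : ∃ a, Sum.elim h l a = s then some (Quotient.mk G (Sum.inr hs.choose)) else none
  have hu : ∀ a, u (Sum.elim f g a) = some (Quotient.mk G (Sum.map id Sum.inl a)) := fun a => by
    have hs : ∃ b, Sum.elim f g b = Sum.elim f g a := ⟨a, rfl⟩
    exact (dif_pos hs).trans (congrArg some (e₁ _ _ hs.choose_spec))
  have hv : ∀ a, v (Sum.elim h l a) = some (Quotient.mk G (Sum.inr a)) := fun a => by
    have hs : ∃ b, Sum.elim h l b = Sum.elim h l a := ⟨a, rfl⟩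
    exact (dif_pos hs).trans (congrArg some (e₂ _ _ hs.choose_spec))
  obtain ⟨d, hd, hd'⟩ := f_isPushout_desc sq u v
    (fun t => (hu (.inr t)).trans (hv (.inl t)).symm)
  let c : Fin n ⊕ Fin k → Fin p := Sum.elim (fun t => i (f t)) (fun t => j (l t))
  have hc : ∀ a, d (c a) = some (Quotient.mk G (Sum.map id Sum.inr a)) := by
    rintro (a | a)
    · exact (hd _).trans (hu (.inl a))
    · exact (hd' _).trans (hv (.inr a))
  ext a b
  constructor
  · intro hab
    exact Quotient.exact (s := G)
      (Option.some_injective _ ((hc a).symm.trans ((congrArg d hab).trans (hc b))))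
  · intro hab
    let c' : Fin n ⊕ Fin m ⊕ Fin k → Fin p :=
      Sum.elim (fun t => i (f t)) (Sum.elim (fun t => i (g t)) (fun t => j (l t)))
    have hG : G ≤ Setoid.ker c' := by
      refine Setoid.eqvGen_le ?_
      rintro _ _ (⟨a, b, hab, rfl, rfl⟩ | ⟨a, b, hab, rfl, rfl⟩)
      · have hc' : ∀ a, c' (Sum.map id Sum.inl a) = i (Sum.elim f g a) := by rintro (a | a) <;> rfl
        exact (hc' a).trans ((congrArg i hab).trans (hc' b).symm)
      · have hc' : ∀ a, c' (Sum.inr a) = j (Sum.elim h l a) := by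
          rintro (a | a)
          · exact w a
          · rfl
        exact (hc' a).trans ((congrArg j hab).trans (hc' b).symm)
    have := hG hab
    rcases a with a | a <;> rcases b with b | b <;> exact this

theorem cospanKer_tensor {a b c d x y : ℕ} (f : Fin a → Fin x) (g : Fin b → Fin x)
    (h : Fin c → Fin y) (l : Fin d → Fin y) :
    cospanKer (finTensor f h) (finTensor g l) =
      (sumSetoid (cospanKer f g) (cospanKer h l)).comap (splitSum a b c d) := by
  have hs : ∀ s, Sum.elim (finTensor f h) (finTensor g l) s =
      Sum.elim (fun t => Fin.castAdd y (Sum.elim f g t)) (fun t => Fin.natAdd x (Sum.elim h l t))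
        (splitSum a b c d s) := by
    rintro (s | s) <;> induction s using fin_cases <;> simp [splitSum]
  ext s t
  change Sum.elim (finTensor f h) (finTensor g l) s = Sum.elim (finTensor f h) (finTensor g l) t ↔
    Sum.LiftRel _ _ (splitSum a b c d s) (splitSum a b c d t)
  rw [hs, hs]
  generalize splitSum a b c d s = s
  generalize splitSum a b c d t = t
  rcases s with s | s <;> rcases t with t | t
  · rw [Sum.liftRel_inl_inl]; simp only [Sum.elim_inl, Fin.castAdd_inj]; rfl
  · simp only [Sum.elim_inl, Sum.elim_inr, Sum.not_liftRel_inl_inr, iff_false]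
    intro hst; have := congrArg Fin.val hst; simp at this; omega
  · simp only [Sum.elim_inl, Sum.elim_inr, Sum.not_liftRel_inr_inl, iff_false]
    intro hst; have := congrArg Fin.val hst; simp at this; omega
  · rw [Sum.liftRel_inr_inr]; simp only [Sum.elim_inr, Fin.natAdd_inj]; rfl

theorem cospanKer_surjective {n m : ℕ} (e : Setoid (Fin n ⊕ Fin m)) :
    ∃ (k : ℕ) (f : Fin n → Fin k) (g : Fin m → Fin k), cospanKer f g = e := by
  let d := Finite.equivFin (Quotient e)
  refine ⟨_, fun t => d (Quotient.mk e (.inl t)), fun t => d (Quotient.mk e (.inr t)), ?_⟩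
  have : ∀ a, Sum.elim (fun t => d (Quotient.mk e (.inl t))) (fun t => d (Quotient.mk e (.inr t))) a
      = d (Quotient.mk e a) := by rintro (a | a) <;> rfl
  ext a b
  change Sum.elim _ _ a = Sum.elim _ _ b ↔ _
  rw [this, this, d.apply_eq_iff_eq]
  exact Quotient.eq

/-- The kernel of an isomorphism class of cospans. -/
def cospanHomKer {n m : ℕ} : CospanHom F n m → Setoid (Fin n ⊕ Fin m) :=
  Quotient.lift (fun x => cospanKer x.left x.right) <| by
    rintro ⟨k, f, g⟩ ⟨k', f', g'⟩ ⟨e, h, h'⟩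
    let f₁ : Fin n → Fin k := f
    let g₁ : Fin m → Fin k := g
    let f₁' : Fin n → Fin k' := f'
    let g₁' : Fin m → Fin k' := g'
    let e₁ : Fin k → Fin k' := e.hom
    have he : Function.Injective e₁ :=
      Function.LeftInverse.injective (g := (e.inv : Fin k' → Fin k)) (congrFun e.hom_inv_id)
    have : ∀ a, Sum.elim f₁' g₁' a = e₁ (Sum.elim f₁ g₁ a) := by
      rintro (a | a)
      · exact (congrFun h a).symm
      · exact (congrFun h' a).symm
    ext a b
    change Sum.elim f₁ g₁ a = Sum.elim f₁ g₁ b ↔ Sum.elim f₁' g₁' a = Sum.elim f₁' g₁' b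
    rw [this, this, he.eq_iff]

/-- The prop `ER` of equivalence relations. -/
noncomputable def ER : PROP.{0} :=
  ofSurjective F.cospan erData cospanHomKer
    (fun e => by
      obtain ⟨k, f, g, h⟩ := cospanKer_surjective e
      exact ⟨cospanMk (C := F) f g, h⟩)
    (fun _ => rfl)
    (fun x y => by
      induction x using cospanMk_ind with | h a f g =>
      induction y using cospanMk_ind with | h b h l =>
      obtain ⟨p, i, j, sq⟩ := exists_isPushout g h
      exact (congrArg cospanHomKer (cospanData_comp_mk f g h l i j sq)).trans
        (cospanKer_comp f g h l i j sq))
    (fun x y => by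
      induction x using cospanMk_ind with | h a f g =>
      induction y using cospanMk_ind with | h b h l =>
      exact cospanKer_tensor f g h l)
    (fun _ _ => rfl)

end PROP

/-!
`Cospan(C)` is glued from `C` and `Cᵒᵖ`: every cospan is `f` followed by `gᵒᵖ`, and a pair of
morphisms out of `C` and `Cᵒᵖ` extends to cospans as soon as it turns pushout squares into
exchange laws. `Corel(C)` imposes on top of this only the equations `m ≫ mᵒᵖ = id`, for `m` in the
right class. When `m` is a monomorphism this equation already holds among spans, where composition
is by pullback, so a morphism out of `Cospan(C)` that agrees with one out of spans has to descend
to corelations. The exchange law of spans survives in corelations because the arrow from the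
pushout of a pullback of injections to the vertex of the original cospan is again an injection.
For functions, a corelation is a jointly surjective cospan, and it is determined by its kernel.
-/

theorem isPushout_coprod_desc {𝒞 : Type u} [Category.{v} 𝒞] {A B X Y Z : 𝒞} [HasBinaryCoproduct A B]
    {a : A ⟶ X} {b : B ⟶ X} {a' : A ⟶ Y} {b' : B ⟶ Y} {x : X ⟶ Z} {y : Y ⟶ Z}
    (ha : a ≫ x = a' ≫ y) (hb : b ≫ x = b' ≫ y)
    (desc : ∀ (T : 𝒞) (g : X ⟶ T) (h : Y ⟶ T), a ≫ g = a' ≫ h → b ≫ g = b' ≫ h →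
      ∃! k : Z ⟶ T, x ≫ k = g ∧ y ≫ k = h) :
    IsPushout (coprod.desc a b) (coprod.desc a' b') x y := by
  have desc' (s : PushoutCocone (coprod.desc a b) (coprod.desc a' b')) :=
    desc s.pt s.inl s.inr
      (by simpa only [coprod.inl_desc_assoc] using congrArg (coprod.inl ≫ ·) s.condition)
      (by simpa only [coprod.inr_desc_assoc] using congrArg (coprod.inr ≫ ·) s.condition)
  choose d hd hd_unique using desc'
  refine ⟨⟨coprod.hom_ext ?_ ?_⟩, ⟨PushoutCocone.IsColimit.mk _ d (fun s => (hd s).1)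
    (fun s => (hd s).2) fun s k hl hr => hd_unique s k ⟨hl, hr⟩⟩⟩
  · simpa only [coprod.inl_desc_assoc] using ha
  · simpa only [coprod.inr_desc_assoc] using hb

namespace PROP

theorem Mor.congr_map {P : PROP.{u}} {Q : PROP.{v}} {K L : Mor P Q} (h : K = L) {n m : ℕ}
    (f : P.Hom n m) : K.map f = L.map f := by rw [h]

theorem Mor.hom_ext {P : PROP.{u}} {Q : PROP.{v}} {K L : Mor P Q}
    (h : ∀ {n m : ℕ} (f : P.Hom n m), K.map f = L.map f) : K = L :=
  Mor.ext (funext fun _ => funext fun _ => funext fun f => h f)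

/-- A morphism of props that is bijective on arrows, as an isomorphism. -/
noncomputable def isoOfBijective {P Q : PROP.{u}} (K : Mor P Q)
    (hK : ∀ n m : ℕ, Function.Bijective (K.map : P.Hom n m → Q.Hom n m)) : P ≅ Q :=
  have map_inv {n m : ℕ} (f : Q.Hom n m) : K.map (Function.surjInv (hK n m).surjective f) = f :=
    Function.surjInv_eq _ f
  { hom := K
    inv :=
      { map := fun {n m} => Function.surjInv (hK n m).surjective
        map_id := fun n => (hK n n).injective <| by rw [map_inv, K.map_id]
        map_comp := fun f g => (hK _ _).injective <| by rw [K.map_comp, map_inv, map_inv, map_inv]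
        map_tensor := fun f g => (hK _ _).injective <| by
          rw [K.map_tensor, map_inv, map_inv, map_inv]
        map_symm := fun a b => (hK _ _).injective <| by rw [map_inv, K.map_symm] }
    hom_inv_id := Mor.hom_ext fun f => Function.leftInverse_surjInv (hK _ _) f
    inv_hom_id := Mor.hom_ext map_inv }

theorem Mor.trans_bijective_of_iso {P Q : PROP.{u}} (φ : P ≅ Q) (R : PROP.{v}) :
    Function.Bijective (Mor.trans φ.hom : Mor Q R → Mor P R) :=
  Function.bijective_iff_has_inverse.2 ⟨Mor.trans φ.inv,
    fun K => congrArg (Mor.trans · K) φ.inv_hom_id, fun K => congrArg (Mor.trans · K) φ.hom_inv_id⟩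

section Cospan

variable {C : PROP.{u}}

theorem Mor.map_op_comp {P : PROP.{v}} (H : Mor C.op P) {n m k : ℕ} (f : C.Hom n m)
    (g : C.Hom m k) : H.map (C.comp f g) = P.comp (H.map g) (H.map f) :=
  H.map_comp (n := k) (m := m) (k := n) g f

theorem Mor.map_op_tensor {P : PROP.{v}} (H : Mor C.op P) {a b c d : ℕ} (f : C.Hom a b)
    (g : C.Hom c d) : H.map (C.tensor f g) = P.tensor (H.map f) (H.map g) :=
  H.map_tensor (a := b) (b := a) (c := d) (d := c) f g

/-- The exchange law for a pair of morphisms out of `C` and `Cᵒᵖ`: pushout squares let the images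
of arrows of `Cᵒᵖ` move to the right of the images of arrows of `C`. This is what a pair needs in
order to extend to cospans. -/
def ExchangesPushouts {P : PROP.{v}} (G : Mor C P) (H : Mor C.op P) : Prop :=
  ∀ ⦃z x y p : ℕ⦄ (f : C.Hom z x) (g : C.Hom z y) (i : C.Hom x p) (j : C.Hom y p),
    IsPushout (C.ar f) (C.ar g) (C.ar i) (C.ar j) →
      P.comp (H.map f) (G.map g) = P.comp (G.map i) (H.map j)

theorem ExchangesPushouts.comp_map_hom {P : PROP.{v}} {G : Mor C P} {H : Mor C.op P}
    (hGH : ExchangesPushouts G H) {k l : ℕ} (e : C.ob k ≅ C.ob l) :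
    P.comp (G.map (e.hom : C.Hom k l)) (H.map (e.hom : C.Hom k l)) = P.id k := by
  have sq : IsPushout (𝟙 (C.ob k)) (𝟙 (C.ob k)) e.hom e.hom := IsPushout.of_horiz_isIso ⟨rfl⟩
  rw [← hGH (C.id k) (C.id k) e.hom e.hom sq, G.map_id, P.comp_id]
  exact H.map_id k

theorem ExchangesPushouts.comp_eq_of_equiv {P : PROP.{v}} {G : Mor C P} {H : Mor C.op P}
    (hGH : ExchangesPushouts G H) {n m : ℕ} {x y : CospanRep C n m} (hxy : x ≈ y) :
    P.comp (G.map x.left) (H.map x.right) = P.comp (G.map y.left) (H.map y.right) := by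
  obtain ⟨e, hl, hr⟩ := hxy
  have hl : C.comp x.left e.hom = y.left := hl
  have hr : C.comp x.right e.hom = y.right := hr
  rw [← hl, ← hr, G.map_comp, H.map_op_comp, P.assoc, ← P.assoc (G.map e.hom),
    hGH.comp_map_hom e, P.id_comp]

variable [MonoidalPushouts C]

theorem cospanOfHom_comp_cospanOfOp {n m k : ℕ} (f : C.Hom n k) (g : C.Hom m k) :
    C.cospan.comp (Mor.map C.cospanOfHom f) (Mor.map C.cospanOfOp g) = cospanMk f g :=
  (cospanData_comp_hom f (C.id k) g).trans (by rw [C.comp_id])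

theorem cospanOfOp_comp_cospanOfHom {z x y p : ℕ} {f : C.Hom z x} {g : C.Hom z y} {i : C.Hom x p}
    {j : C.Hom y p} (sq : IsPushout (C.ar f) (C.ar g) (C.ar i) (C.ar j)) :
    C.cospan.comp (Mor.map C.cospanOfOp f) (Mor.map C.cospanOfHom g) = cospanMk i j :=
  (cospanData_comp_mk (C.id x) f g (C.id y) i j sq).trans (by rw [C.id_comp, C.id_comp])

theorem cospan_hom_ext {P : PROP.{v}} {K L : Mor C.cospan P}
    (h_hom : Mor.trans C.cospanOfHom K = Mor.trans C.cospanOfHom L)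
    (h_op : Mor.trans C.cospanOfOp K = Mor.trans C.cospanOfOp L) : K = L := by
  refine Mor.hom_ext fun x => ?_
  induction x using cospanMk_ind with | h k f g =>
  rw [← cospanOfHom_comp_cospanOfOp, K.map_comp, L.map_comp]
  exact congrArg₂ P.comp (Mor.congr_map h_hom f) (Mor.congr_map h_op g)

/-- The morphism out of `Cospan(C)` that a pair of morphisms with the exchange law determines. -/
def cospanDesc {P : PROP.{v}} (G : Mor C P) (H : Mor C.op P) (hGH : ExchangesPushouts G H) :
    Mor C.cospan P where
  map {n m} := Quotient.lift (fun x : CospanRep C n m => P.comp (G.map x.left) (H.map x.right))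
    fun _ _ => hGH.comp_eq_of_equiv
  map_id n := (congrArg₂ P.comp (G.map_id n) (H.map_id n)).trans (P.id_comp _)
  map_comp x y := by
    induction x using cospanMk_ind with | h a f g =>
    induction y using cospanMk_ind with | h b h l =>
    obtain ⟨p, i, j, sq⟩ := exists_isPushout g h
    refine (congrArg _ (cospanData_comp_mk f g h l i j sq)).trans ?_
    change P.comp (G.map (C.comp f i)) (H.map (C.comp l j)) =
      P.comp (P.comp (G.map f) (H.map g)) (P.comp (G.map h) (H.map l))
    rw [G.map_comp, H.map_op_comp, P.assoc, P.assoc, ← P.assoc (H.map g), hGH g h i j sq, P.assoc]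
  map_tensor x y := by
    induction x using cospanMk_ind with | h k f g =>
    induction y using cospanMk_ind with | h l f' g' =>
    change P.comp (G.map (C.tensor f f')) (H.map (C.tensor g g')) =
      P.tensor (P.comp (G.map f) (H.map g)) (P.comp (G.map f') (H.map g'))
    rw [G.map_tensor, H.map_op_tensor, P.tensor_comp]
  map_symm a b := (congrArg₂ P.comp (G.map_symm a b) (H.map_id (b + a))).trans (P.comp_id _)

theorem cospanOfHom_trans_cospanDesc {P : PROP.{v}} {G : Mor C P} {H : Mor C.op P}
    (hGH : ExchangesPushouts G H) : Mor.trans C.cospanOfHom (cospanDesc G H hGH) = G :=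
  Mor.hom_ext fun {_ m} f =>
    (congrArg (P.comp (G.map f)) (H.map_id m)).trans (P.comp_id _)

theorem cospanOfOp_trans_cospanDesc {P : PROP.{v}} {G : Mor C P} {H : Mor C.op P}
    (hGH : ExchangesPushouts G H) : Mor.trans C.cospanOfOp (cospanDesc G H hGH) = H :=
  Mor.hom_ext fun {n _} f =>
    (congrArg (P.comp · (H.map f)) (G.map_id n)).trans (P.id_comp _)

end Cospan

section Corel

variable {C : PROP.{u}} [MonoidalPushouts C] (S : CostableSystem C)

/-- The morphism out of `Corel(C)` induced by one out of `Cospan(C)` that sends `i` followed by its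
opposite to the identity, for every `i` in the right class. -/
def corelDesc {P : PROP.{v}} (G : Mor C.cospan P)
    (hG : ∀ {k l : ℕ} (i : C.Hom k l), S.M (C.ar i) →
      P.comp (G.map (Mor.map C.cospanOfHom i)) (G.map (Mor.map C.cospanOfOp i)) = P.id k) :
    Mor (corel S) P where
  map := Quot.lift G.map <| by
    rintro _ _ ⟨k, l, f, g, i, hi, rfl, rfl⟩
    rw [← cospanOfHom_comp_cospanOfOp, ← cospanOfHom_comp_cospanOfOp, Mor.map_comp C.cospanOfHom,
      Mor.map_op_comp C.cospanOfOp, G.map_comp, G.map_comp, G.map_comp, G.map_comp, P.assoc,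
      ← P.assoc (G.map (Mor.map C.cospanOfHom i)), hG i hi, P.id_comp]
  map_id := G.map_id
  map_comp := by rintro n m k ⟨x⟩ ⟨y⟩; exact G.map_comp x y
  map_tensor := by rintro a b c d ⟨x⟩ ⟨y⟩; exact G.map_tensor x y
  map_symm := G.map_symm

variable {S}

theorem corel_hom_ext {P : PROP.{v}} {K L : Mor (corel S) P}
    (h : Mor.trans (cospanToCorel S) K = Mor.trans (cospanToCorel S) L) : K = L := by
  refine Mor.hom_ext fun x => ?_
  obtain ⟨x, rfl⟩ := Quot.exists_rep x
  exact Mor.congr_map h x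

theorem corelMk_comp {n m k l : ℕ} (f : C.Hom n k) (g : C.Hom m k) {i : C.Hom k l}
    (hi : S.M (C.ar i)) : corelMk S (C.comp f i) (C.comp g i) = corelMk S f g :=
  (Quot.sound ⟨k, l, f, g, i, hi, rfl, rfl⟩).symm

variable (S)

/-- The morphism `C → Corel(C)` that sends `f` to the corelation of the cospan `(f, id)`. -/
noncomputable def corelOfHom : Mor C (corel S) := C.cospanOfHom ≫ cospanToCorel S

/-- The morphism `Cᵒᵖ → Corel(C)` that sends `g` to the corelation of the cospan `(id, g)`. -/
noncomputable def corelOfOp : Mor C.op (corel S) := C.cospanOfOp ≫ cospanToCorel S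

variable {S}

theorem corelOfHom_comp_corelOfOp {n m k : ℕ} (f : C.Hom n k) (g : C.Hom m k) :
    (corel S).comp ((corelOfHom S).map f) ((corelOfOp S).map g) = corelMk S f g :=
  congrArg (Mor.map (cospanToCorel S)) (cospanOfHom_comp_cospanOfOp f g)

theorem corelOfOp_comp_corelOfHom {z x y p : ℕ} {f : C.Hom z x} {g : C.Hom z y} {i : C.Hom x p}
    {j : C.Hom y p} (sq : IsPushout (C.ar f) (C.ar g) (C.ar i) (C.ar j)) :
    (corel S).comp ((corelOfOp S).map f) ((corelOfHom S).map g) = corelMk S i j :=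
  congrArg (Mor.map (cospanToCorel S)) (cospanOfOp_comp_cospanOfHom sq)

end Corel

section Span

variable {A : PROP.{u}}

theorem epi_op_of_mono {k l : ℕ} (a : A.Hom k l) [Mono (A.ar a)] : Epi (A.op.ar a) :=
  ⟨fun {Z} g h w => (cancel_mono (A.ar a) (Z := A.ob Z.n) (g := g) (h := h)).1 w⟩

theorem spanOfHom_comp_spanOfOp_of_mono [MonoidalPushouts A.op] {k l : ℕ} (a : A.Hom k l)
    [Mono (A.ar a)] :
    A.span.comp (Mor.map A.spanOfHom a) (Mor.map A.spanOfOp a) = A.span.id k :=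
  have := epi_op_of_mono a
  cospanOfOp_comp_cospanOfHom (C := A.op) ((epi_iff_isPushout (A.op.ar a)).1 this)

end Span

section SpanToCorel

variable {C : PROP.{u}} {A : PROP.{v}} (S : CostableSystem C) (ι : Mor A C)

/-- Pushouts of pullbacks compare well along `ι`: for a pullback square `(f, g, h, i)` in `A`, the
arrow from a pushout in `C` of the images of `h` and `i` to the vertex of `f` and `g` lies in the
right class. It is the condition under which spans in `A` map to corelations. Pullbacks in `A` are
encoded as pushouts in its opposite. -/
def PullbackComparisonMem : Prop :=
  ∀ ⦃z x y p q : ℕ⦄ (f : A.Hom x z) (g : A.Hom y z) (h : A.Hom p x) (i : A.Hom p y)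
    (k : C.Hom x q) (l : C.Hom y q) (d : C.Hom q z),
    IsPushout (A.op.ar f) (A.op.ar g) (A.op.ar h) (A.op.ar i) →
    IsPushout (C.ar (ι.map h)) (C.ar (ι.map i)) (C.ar k) (C.ar l) →
    C.comp k d = ι.map f → C.comp l d = ι.map g → S.M (C.ar d)

variable {S ι} [MonoidalPushouts C]

theorem PullbackComparisonMem.exchangesPushouts (hι : PullbackComparisonMem S ι) :
    ExchangesPushouts (C := A.op) (Mor.trans ι.op (corelOfOp S))
      (Mor.trans ι (corelOfHom S)) := by
  intro z x y p f g h i sq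
  let f' : A.Hom x z := f
  let g' : A.Hom y z := g
  obtain ⟨q, k, l, po⟩ := exists_isPushout (C := C) (ι.map h) (ι.map i)
  have w : C.ar (ι.map h) ≫ C.ar (ι.map f') = C.ar (ι.map i) ≫ C.ar (ι.map g') := by
    let h' : A.Hom p x := h
    let i' : A.Hom p y := i
    exact (ι.map_comp h' f').symm.trans ((congrArg ι.map sq.w).trans (ι.map_comp i' g'))
  let d : C.Hom q z := po.desc (C.ar (ι.map f')) (C.ar (ι.map g')) w
  have hk : C.comp k d = ι.map f' := po.inl_desc _ _ w
  have hl : C.comp l d = ι.map g' := po.inr_desc _ _ w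
  calc (corel S).comp ((corelOfHom S).map (ι.map f')) ((corelOfOp S).map (ι.map g'))
      = corelMk S (ι.map f') (ι.map g') := corelOfHom_comp_corelOfOp _ _
    _ = corelMk S (C.comp k d) (C.comp l d) := by rw [hk, hl]
    _ = corelMk S k l := corelMk_comp k l (hι f' g' h i k l d sq po hk hl)
    _ = (corel S).comp ((corelOfOp S).map (ι.map h)) ((corelOfHom S).map (ι.map i)) :=
      (corelOfOp_comp_corelOfHom po).symm

variable [MonoidalPushouts A.op]

/-- The morphism `Π : Span(A) → Corel(C)` that sends a span to the corelation of its pushout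
in `C`. -/
noncomputable def spanToCorel (hι : PullbackComparisonMem S ι) : Mor A.span (corel S) :=
  cospanDesc (C := A.op) _ _ hι.exchangesPushouts

theorem spanToCorel_spanMk (hι : PullbackComparisonMem S ι) {n m k p : ℕ} (f : A.Hom k n)
    (g : A.Hom k m) {i : C.Hom n p} {j : C.Hom m p}
    (sq : IsPushout (C.ar (ι.map f)) (C.ar (ι.map g)) (C.ar i) (C.ar j)) :
    (spanToCorel hι).map (spanMk f g) = corelMk S i j :=
  corelOfOp_comp_corelOfHom sq

theorem spanOfHom_trans_spanToCorel (hι : PullbackComparisonMem S ι) :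
    Mor.trans A.spanOfHom (spanToCorel hι) = Mor.trans ι (corelOfHom S) :=
  cospanOfOp_trans_cospanDesc (C := A.op) hι.exchangesPushouts

theorem spanOfOp_trans_spanToCorel (hι : PullbackComparisonMem S ι) :
    Mor.trans A.spanOfOp (spanToCorel hι) = Mor.trans ι.op (corelOfOp S) :=
  cospanOfHom_trans_cospanDesc (C := A.op) hι.exchangesPushouts

theorem corel_existsUnique_desc (hι : PullbackComparisonMem S ι)
    (hM : ∀ ⦃k l : ℕ⦄ (i : C.Hom k l), S.M (C.ar i) → ∃ a : A.Hom k l, Mono (A.ar a) ∧ ι.map a = i)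
    {P : PROP.{w}} {G : Mor C.cospan P} {H : Mor A.span P}
    (h_hom : Mor.trans (Mor.trans ι C.cospanOfHom) G = Mor.trans A.spanOfHom H)
    (h_op : Mor.trans (Mor.trans ι.op C.cospanOfOp) G = Mor.trans A.spanOfOp H) :
    ∃! K : Mor (corel S) P,
      Mor.trans (cospanToCorel S) K = G ∧ Mor.trans (spanToCorel hι) K = H := by
  have hG {k l : ℕ} (i : C.Hom k l) (hi : S.M (C.ar i)) :
      P.comp (G.map (Mor.map C.cospanOfHom i)) (G.map (Mor.map C.cospanOfOp i)) = P.id k := by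
    obtain ⟨a, _, rfl⟩ := hM i hi
    calc P.comp (G.map (Mor.map C.cospanOfHom (ι.map a))) (G.map (Mor.map C.cospanOfOp (ι.map a)))
        = P.comp (H.map (Mor.map A.spanOfHom a)) (H.map (Mor.map A.spanOfOp a)) :=
          congrArg₂ P.comp (Mor.congr_map h_hom a) (Mor.congr_map h_op a)
      _ = H.map (A.span.id k) := by rw [← H.map_comp, spanOfHom_comp_spanOfOp_of_mono]
      _ = P.id k := H.map_id k
  have descends_to_H : Mor.trans (spanToCorel hι) (corelDesc S G hG) = H :=
    cospan_hom_ext (C := A.op)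
      ((congrArg (Mor.trans · (corelDesc S G hG)) (spanOfOp_trans_spanToCorel hι)).trans h_op)
      ((congrArg (Mor.trans · (corelDesc S G hG)) (spanOfHom_trans_spanToCorel hι)).trans h_hom)
  exact ⟨corelDesc S G hG, ⟨rfl, descends_to_H⟩, fun K hK => corel_hom_ext hK.1⟩

end SpanToCorel

theorem corel_isPushout {A C : PROP.{u}} [MonoidalPushouts C] [MonoidalPushouts A.op]
    {S : CostableSystem C} {ι : A ⟶ C} (hι : PullbackComparisonMem S ι)
    (hM : ∀ ⦃k l : ℕ⦄ (i : C.Hom k l), S.M (C.ar i) →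
      ∃ a : A.Hom k l, Mono (A.ar a) ∧ Mor.map ι a = i) :
    IsPushout
      (coprod.desc (ι ≫ C.cospanOfHom) (Mor.op ι ≫ C.cospanOfOp) : A ⨿ A.op ⟶ C.cospan)
      (coprod.desc A.spanOfHom A.spanOfOp : A ⨿ A.op ⟶ A.span)
      (cospanToCorel S) (spanToCorel hι) :=
  isPushout_coprod_desc (spanOfHom_trans_spanToCorel hι).symm (spanOfOp_trans_spanToCorel hι).symm
    fun _ _ _ h_hom h_op => corel_existsUnique_desc hι hM h_hom h_op

section Kernel

/-- The morphism `Cospan(F) → ER` that sends a cospan to the kernel of the copairing of its legs. -/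
noncomputable def cospanToER : Mor F.cospan ER where
  map x := cospanHomKer x
  map_id _ := rfl
  map_comp x y := by
    induction x using cospanMk_ind with | h a f g =>
    induction y using cospanMk_ind with | h b h l =>
    obtain ⟨p, i, j, sq⟩ := exists_isPushout g h
    exact (congrArg cospanHomKer (cospanData_comp_mk f g h l i j sq)).trans
      (cospanKer_comp f g h l i j sq)
  map_tensor x y := by
    induction x using cospanMk_ind with | h a f g =>
    induction y using cospanMk_ind with | h b h l =>
    exact cospanKer_tensor f g h l
  map_symm _ _ := rfl

theorem cospanKer_self_of_injective {k l : ℕ} {i : Fin k → Fin l} (hi : Function.Injective i) :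
    cospanKer i i = ER.id k := by
  ext a b
  rcases a with a | a <;> rcases b with b | b <;> exact hi.eq_iff

/-- The morphism `Corel(F) → ER` that sends a corelation to the kernel of a representative. -/
noncomputable def corelToER : Mor (corel surjInj) ER :=
  corelDesc surjInj cospanToER fun i hi => by
    rw [← Mor.map_comp, cospanOfHom_comp_cospanOfOp]
    exact cospanKer_self_of_injective hi

theorem exists_surjective_corelMk_eq {n m : ℕ} (x : (corel surjInj).Hom n m) :
    ∃ (k : ℕ) (f : Fin n → Fin k) (g : Fin m → Fin k),
      Function.Surjective (Sum.elim f g) ∧ corelMk surjInj f g = x := by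
  obtain ⟨x, rfl⟩ := Quot.exists_rep x
  induction x using cospanMk_ind with | h l f g =>
  obtain ⟨k, e, i, he, hi, hfac⟩ := exists_surj_inj (Fin.append (α := Fin l) f g)
  have hf : (fun t => i (e (Fin.castAdd m t))) = f :=
    funext fun t => (hfac _).trans (Fin.append_left _ _ t)
  have hg : (fun t => i (e (Fin.natAdd n t))) = g :=
    funext fun t => (hfac _).trans (Fin.append_right _ _ t)
  refine ⟨k, fun t => e (Fin.castAdd m t), fun t => e (Fin.natAdd n t), ?_, ?_⟩
  · have h : Sum.elim (fun t => e (Fin.castAdd m t)) (fun t => e (Fin.natAdd n t)) =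
        e ∘ finSumFinEquiv := by
      funext t
      rcases t with t | t <;> simp
    exact h ▸ he.comp finSumFinEquiv.surjective
  · exact (corelMk_comp (C := F) (S := surjInj) (fun t => e (Fin.castAdd m t))
      (fun t => e (Fin.natAdd n t)) hi).symm.trans (congrArg₂ (corelMk surjInj) hf hg)

theorem exists_equiv_of_ker_eq {α β γ : Type*} {u : α → β} {v : α → γ}
    (hu : Function.Surjective u) (hv : Function.Surjective v)
    (h : Setoid.ker u = Setoid.ker v) : ∃ e : β ≃ γ, ∀ a, e (u a) = v a := by
  let eu := Setoid.quotientKerEquivOfSurjective u hu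
  let ev := Setoid.quotientKerEquivOfSurjective v hv
  let q : Quotient (Setoid.ker u) ≃ Quotient (Setoid.ker v) :=
    Quotient.congrRight fun a b => by rw [h]
  have eu_symm (a : α) : eu.symm (u a) = Quotient.mk _ a := eu.symm_apply_eq.2 rfl
  exact ⟨eu.symm.trans (q.trans ev), fun a => congrArg (fun x => ev (q x)) (eu_symm a)⟩

/-- A bijection of finite ordinals, as an isomorphism of `F`. -/
def isoOfEquiv {k l : ℕ} (e : Fin k ≃ Fin l) : F.ob k ≅ F.ob l where
  hom := fun t => e t
  inv := fun t => e.symm t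
  hom_inv_id := funext e.symm_apply_apply
  inv_hom_id := funext e.apply_symm_apply

theorem cospanMk_eq_of_cospanKer_eq {n m k l : ℕ} {f : Fin n → Fin k} {g : Fin m → Fin k}
    {f' : Fin n → Fin l} {g' : Fin m → Fin l} (hs : Function.Surjective (Sum.elim f g))
    (hs' : Function.Surjective (Sum.elim f' g')) (h : cospanKer f g = cospanKer f' g') :
    cospanMk (C := F) f g = cospanMk (C := F) f' g' := by
  obtain ⟨e, he⟩ := exists_equiv_of_ker_eq hs hs' h
  exact cospanMk_eq_iff.2
    ⟨isoOfEquiv e, funext fun t => he (.inl t), funext fun t => he (.inr t)⟩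

theorem corelToER_bijective (n m : ℕ) :
    Function.Bijective (corelToER.map : (corel surjInj).Hom n m → ER.Hom n m) := by
  constructor
  · intro x y hxy
    obtain ⟨k, f, g, hfg, rfl⟩ := exists_surjective_corelMk_eq x
    obtain ⟨l, f', g', hfg', rfl⟩ := exists_surjective_corelMk_eq y
    exact congrArg (Quot.mk _) (cospanMk_eq_of_cospanKer_eq hfg hfg' hxy)
  · intro e
    obtain ⟨k, f, g, hfg⟩ := cospanKer_surjective e
    exact ⟨corelMk surjInj f g, hfg⟩

/-- The isomorphism `φ : Corel(F) ≅ ER`. -/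
noncomputable def corelIsoER : corel surjInj ≅ ER := isoOfBijective corelToER corelToER_bijective

end Kernel

section Injections

theorem injective_of_jointly_surjective {α β γ δ : Type*} {k : α → γ} {l : β → γ} {d : γ → δ}
    (hs : ∀ s, (∃ a, k a = s) ∨ ∃ b, l b = s) (hk : Function.Injective (d ∘ k))
    (hl : Function.Injective (d ∘ l)) (hkl : ∀ a b, d (k a) = d (l b) → k a = l b) :
    Function.Injective d := by
  intro s t hst
  obtain ⟨a, rfl⟩ | ⟨a, rfl⟩ := hs s <;> obtain ⟨b, rfl⟩ | ⟨b, rfl⟩ := hs t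
  · exact congrArg k (hk hst)
  · exact hkl a b hst
  · exact (hkl b a hst.symm).symm
  · exact congrArg l (hl hst)

theorem pullbackComparisonMem_injIncl : PullbackComparisonMem surjInj injIncl := by
  intro z x y p q f g h i k l d sq po hk hl
  have hk' : d ∘ k = f.1 := hk
  have hl' : d ∘ l = g.1 := hl
  refine injective_of_jointly_surjective (f_isPushout_surj po) (hk' ▸ f.2) (hl' ▸ g.2) ?_
  intro a b hab
  obtain ⟨t, rfl, rfl⟩ := inj_isPullback_ex sq a b
    ((congrFun hk a).symm.trans (hab.trans (congrFun hl b)))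
  exact congrFun po.w t

theorem mono_inj {k l : ℕ} (i : InjFun k l) : Mono (Inj.ar i) :=
  ⟨fun _ _ h => Subtype.ext (p := Function.Injective)
    (i.2.comp_left (congrArg (Subtype.val (p := Function.Injective)) h))⟩

theorem exists_mono_injIncl_eq ⦃k l : ℕ⦄ (i : F.Hom k l) (hi : surjInj.M (F.ar i)) :
    ∃ a : Inj.Hom k l, Mono (Inj.ar a) ∧ Mor.map injIncl a = i :=
  ⟨⟨i, hi⟩, mono_inj ⟨i, hi⟩, rfl⟩

end Injections

end PROP

theorem mainTheorem9 :
    ∃ (φ : PROP.corel PROP.surjInj ≅ PROP.ER) (Pi : PROP.Inj.span ⟶ PROP.corel PROP.surjInj),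
      (∀ (n m k : ℕ) (f : Fin n → Fin k) (g : Fin m → Fin k),
        PROP.Mor.map φ.hom (PROP.corelMk PROP.surjInj f g) = Setoid.ker (Sum.elim f g)) ∧
      (∀ (n m k p : ℕ) (f : PROP.InjFun k n) (g : PROP.InjFun k m) (i : Fin n → Fin p)
        (j : Fin m → Fin p),
        IsPushout (PROP.F.ar f.1) (PROP.F.ar g.1) (PROP.F.ar i) (PROP.F.ar j) →
          PROP.Mor.map Pi (PROP.spanMk (A := PROP.Inj) f g) = PROP.corelMk PROP.surjInj i j) ∧
      IsPushout
        (coprod.desc (PROP.injIncl ≫ PROP.F.cospanOfHom)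
          (PROP.Mor.op PROP.injIncl ≫ PROP.F.cospanOfOp) :
          PROP.Inj ⨿ PROP.Inj.op ⟶ PROP.F.cospan)
        (coprod.desc PROP.Inj.spanOfHom PROP.Inj.spanOfOp :
          PROP.Inj ⨿ PROP.Inj.op ⟶ PROP.Inj.span)
        (PROP.cospanToCorel PROP.surjInj ≫ φ.hom) (Pi ≫ φ.hom) ∧
      ∀ (P : PROP.{w}) (G : PROP.Mor PROP.F.cospan P) (H : PROP.Mor PROP.Inj.span P),
        PROP.Mor.trans (PROP.injIncl ≫ PROP.F.cospanOfHom) G =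
          PROP.Mor.trans PROP.Inj.spanOfHom H →
        PROP.Mor.trans (PROP.Mor.op PROP.injIncl ≫ PROP.F.cospanOfOp) G =
          PROP.Mor.trans PROP.Inj.spanOfOp H →
        ∃! K : PROP.Mor PROP.ER P,
          PROP.Mor.trans (PROP.cospanToCorel PROP.surjInj ≫ φ.hom) K = G ∧
            PROP.Mor.trans (Pi ≫ φ.hom) K = H := by
  have hι := PROP.pullbackComparisonMem_injIncl
  have hM := PROP.exists_mono_injIncl_eq
  refine ⟨PROP.corelIsoER, PROP.spanToCorel hι, fun _ _ _ _ _ => rfl,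
    fun _ _ _ _ f g _ _ sq => PROP.spanToCorel_spanMk hι f g sq, ?_, fun P _ _ h_hom h_op => ?_⟩
  · exact (PROP.corel_isPushout hι hM).of_iso (Iso.refl _) (Iso.refl _) (Iso.refl _)
      PROP.corelIsoER (by simp) (by simp) (by simp) (by simp)
  · exact (PROP.Mor.trans_bijective_of_iso PROP.corelIsoER P).existsUnique_iff.1
      (PROP.corel_existsUnique_desc hι hM h_hom h_op)
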